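/- For an integer $m\ge 0$ write $[m]=1+q+\cdots+q^{m-1}$, $(x;q)_m=\prod_{i=0}^{m-1}(1-xq^i)$ and $(x_1,\ldots,x_r;q)_m=(x_1;q)_m\cdots(x_r;q)_m$, and let $\Phi_n(q)$ be the $n$-th cyclotomic polynomial. Two rational functions (in $q$, or in $a$ and $q$, over $\mathbb{Q}$) are congruent modulo a polynomial $P$ if their difference can be written as a fraction of polynomials whose numerator is divisible by $P$ and whose denominator is relatively prime to $P$. Let $n$ be a positive odd integer. (i) For $k\ge 0$ let $$c_q(k)=[3k+1]\frac{(q;q^2)_k^3\,q^{-\binom{k+1}{2}}}{(q;q)_k^2\,(q^2;q^2)_k}.$$ If $n>1$, then $$\sum_{k=0}^{n-1}\sum_{j=0}^{k}c_q(j)\,c_q(k-j)\equiv q[n]^2\pmod{[n]\Phi_n(q)^2}.$$ (ii) Let $a$ be an indeterminate, and for $k\ge 0$ let $$c_{a,q}(k)=[3k+1]\frac{(aq,q/a,q;q^2)_k\,q^{-\binom{k+1}{2}}}{(aq,q/a;q)_k\,(q^2;q^2)_k}.$$ Then $$\sum_{k=0}^{n-1}\sum_{j=0}^{k}c_{a,q}(j)\,c_{a,q}(k-j)\equiv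 q^{1-n}[n]^2\pmod{[n](1-aq^n)(a-q^n)}.$$ -/

import Mathlib

open Polynomial

/-- The `q`-integer `[n] = 1 + q + ⋯ + q^(n-1)`. -/
def qInt {R : Type*} [CommRing R] (q : R) (n : ℕ) : R :=
  ∑ i ∈ Finset.range n, q ^ i

/-- The `q`-shifted factorial `(a;q)_n = (1-a)(1-aq)⋯(1-aq^(n-1))`. -/
def qPoch {R : Type*} [CommRing R] (a q : R) (n : ℕ) : R :=
  ∏ i ∈ Finset.range n, (1 - a * q ^ i)

/-- `c_q(k) = [3k+1] (q;q²)_k³ q^(-binom(k+1,2)) / ((q;q)_k² (q²;q²)_k)`. -/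
def cTerm {K : Type*} [Field K] (q : K) (k : ℕ) : K :=
  qInt q (3 * k + 1) *
    (qPoch q (q ^ 2) k ^ 3 * q ^ (-((k + 1).choose 2 : ℤ)) /
      (qPoch q q k ^ 2 * qPoch (q ^ 2) (q ^ 2) k))

/-- The version of `c_q(k)` with an extra parameter `a`:
`[3k+1] (aq, q/a, q; q²)_k q^(-binom(k+1,2)) / ((aq, q/a; q)_k (q²;q²)_k)`. -/
def cTermParam {K : Type*} [Field K] (a q : K) (k : ℕ) : K :=
  qInt q (3 * k + 1) *
    (qPoch (a * q) (q ^ 2) k * qPoch (q / a) (q ^ 2) k * qPoch q (q ^ 2) k *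
        q ^ (-((k + 1).choose 2 : ℤ)) /
      (qPoch (a * q) q k * qPoch (q / a) q k * qPoch (q ^ 2) (q ^ 2) k))

/-- The truncated square `∑_{k=0}^{n-1} ∑_{j=0}^{k} c(j) c(k-j)`. -/
def truncSquare {K : Type*} [Field K] (c : ℕ → K) (n : ℕ) : K :=
  ∑ k ∈ Finset.range n, ∑ j ∈ Finset.range (k + 1), c j * c (k - j)

/-- Congruence of rational functions `f, g` modulo a polynomial `P`: `f - g` can be written as a
fraction whose numerator is divisible by `P` and whose denominator has no common factor with `P`.
Here `A` is the polynomial ring and `K` its field of fractions. -/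
def RatCongr {A K : Type*} [CommRing A] [Field K] [Algebra A K] (P : A) (f g : K) : Prop :=
  ∃ N D : A, D ≠ 0 ∧ IsRelPrime D P ∧ f - g = algebraMap A K (P * N) / algebraMap A K D

/-! ### Elementary rules for q-shifted factorials. -/

section QPoch

variable {R : Type*} [CommRing R]

/-! The modulus splits into coprime factors, and each factor is tested at its zeros. At `a = q^n`
and `a = q^(-n)`, with `n = 2N+1`, all terms past index `N` vanish, so the truncated square is the
square of the full sum. A terminating quadratic summation (`sum_quadTerm`) evaluates that sum to
`[n] q^(-N)`, whose square is the right-hand side. At a primitive `d`-th root of unity, `d ∣ n`, `d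
> 1`, the terms repeat in blocks of length `d` up to scalars, vanish in the second half of each
block, and sum to zero over a block by the same summation. Hence every partial sum covering the
first half of its last block is zero, the truncated square vanishes (`truncSquare_eq_zero`), and so
does `[n]`. This gives (ii).

For (i), the root-of-unity argument at `a = 1` gives divisibility by `[n]`. Setting `a = 1` in (ii)
turns the modulus into `[n](1-q^n)²`; denominators may then cancel `Φ_d` with `d < n`, but not
`Φ_n`, so `Φ_n³` survives. `SpecializesTo` records which denominators survive a substitution. -/

@[simp] lemma qPoch_zero (a q : R) : qPoch a q 0 = 1 := by simp [qPoch]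

lemma qPoch_succ (a q : R) (k : ℕ) : qPoch a q (k + 1) = qPoch a q k * (1 - a * q ^ k) := by
  simp [qPoch, Finset.prod_range_succ]

lemma qPoch_succ' (a q : R) (k : ℕ) : qPoch a q (k + 1) = (1 - a) * qPoch (a * q) q k := by
  simp only [qPoch, Finset.prod_range_succ', pow_zero, mul_one]
  rw [mul_comm]
  congr 1
  refine Finset.prod_congr rfl fun i _ => ?_
  ring

lemma qPoch_ne_zero [IsDomain R] {a q : R} {k : ℕ} (h : ∀ i < k, 1 - a * q ^ i ≠ 0) :
    qPoch a q k ≠ 0 :=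
  Finset.prod_ne_zero_iff.2 fun i hi => h i (Finset.mem_range.1 hi)

lemma qPoch_eq_zero {a q : R} {k : ℕ} (i : ℕ) (hi : i < k) (h : a * q ^ i = 1) :
    qPoch a q k = 0 :=
  Finset.prod_eq_zero (Finset.mem_range.2 hi) (by rw [h, sub_self])

lemma one_sub_mul_qInt (q : R) (n : ℕ) : (1 - q) * qInt q n = 1 - q ^ n := by
  rw [qInt, mul_comm]
  exact geom_sum_mul_neg q n

end QPoch

/-! ### A terminating quadratic summation by telescoping. -/

section QuadraticSum

variable {K : Type*} [Field K]

/-- The summand of the terminating quadratic summation. -/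
def quadTerm (q x M : K) (k : ℕ) : K :=
  (1 - q ^ (3 * k + 1)) *
    (qPoch x (q ^ 2) k * qPoch (M * q ^ 3 / x) (q ^ 2) k * qPoch (1 / M) (q ^ 2) k * qPoch q q k *
      q ^ (-((k + 1).choose 2 : ℤ))) /
    (qPoch (q ^ 2) (q ^ 2) k * qPoch (q ^ 2 / x) q k * qPoch (x / (M * q)) q k *
      qPoch (M * q ^ 2) q k)

/-- The companion of `quadTerm` under the shift `M ↦ M q²`. -/
def quadCert (q x M : K) (k : ℕ) : K :=
  (1 - M * q ^ 2) * (1 - M * q ^ 3) * (x - M ^ 2 * q ^ 5) /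
      (q * (1 - x / (M * q ^ 3)) * (q ^ 2 * M)) *
    (qPoch x (q ^ 2) (k + 1) * qPoch (M * q ^ 3 / x) (q ^ 2) (k + 1) * qPoch (1 / M) (q ^ 2) k *
      qPoch q q (k + 1) * q ^ (-((k + 1).choose 2 : ℤ))) /
    (qPoch (q ^ 2) (q ^ 2) k * qPoch (q ^ 2 / x) q k * qPoch (x / (M * q)) q k *
      qPoch (M * q ^ 2) q (k + 2))

lemma zpow_neg_choose_succ {q : K} (hq : q ≠ 0) (k : ℕ) :
    q ^ (-((k + 1 + 1).choose 2 : ℤ)) = q ^ (-((k + 1).choose 2 : ℤ)) * (q ^ (k + 1))⁻¹ := by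
  rw [Nat.choose_succ_succ' (k + 1) 1, Nat.choose_one_right, ← zpow_natCast, ← zpow_neg,
    ← zpow_add₀ hq]
  push_cast
  congr 1
  ring

/-- The rational function identity behind `quadCert_succ`, with `Q = q ^ (k + 1)`. -/
lemma quad_rational_identity {q x M Q : K} (hq : q ≠ 0) (hx : x ≠ 0) (hM : M ≠ 0) (hQ : Q ≠ 0)
    (h1 : 1 - Q ^ 2 ≠ 0) (h2 : x - q * Q ≠ 0) (h3 : M * q ^ 3 - x ≠ 0)
    (h3' : M * q ^ 2 - x ≠ 0) (h3'' : M * q ^ 2 - x * Q ≠ 0)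
    (h4 : 1 - M * q ^ 3 * Q ≠ 0) (h5 : 1 - M * q ^ 2 ≠ 0) (h6 : 1 - M * q ^ 3 ≠ 0)
    (h8 : M * q ^ 3 - x * Q ≠ 0) (h9 : x - M * q ^ 3 ≠ 0) :
    x * (1 - M * q ^ 2 / x) * (1 - M * q ^ 3 / x) * ((1 - q * Q ^ 3) *
        ((1 - M * q ^ 3 / x * Q ^ 2) / (1 - M * q ^ 3 / x) * (1 - 1 / (M * q ^ 2)) * Q⁻¹) /
        ((1 - Q ^ 2) * (1 - q * Q / x) *
          ((1 - x / (M * q ^ 3)) * (1 - x / (M * q ^ 2)) / (1 - x * Q / (M * q ^ 3))) *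
          ((1 - M * q ^ 3 * Q) / ((1 - M * q ^ 2) * (1 - M * q ^ 3))))) -
      (1 - M * q ^ 2) * (1 - M * q ^ 3) * ((1 - q * Q ^ 3) *
        ((1 - Q ^ 2 / (M * q ^ 2)) * Q⁻¹) /
        ((1 - Q ^ 2) * (1 - q * Q / x) * (1 - x * Q / (M * q ^ 2)) * (1 - M * q ^ 2 * Q)⁻¹)) =
      (1 - M * q ^ 2) * (1 - M * q ^ 3) * (x - M ^ 2 * q ^ 5) /
        (q * (1 - x / (M * q ^ 3)) * (q ^ 2 * M)) *
        ((1 - x * Q ^ 2) * (1 - M * q ^ 3 / x * Q ^ 2) * (1 - Q ^ 2 / (M * q ^ 2)) *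
          (1 - q * Q) * Q⁻¹ / ((1 - Q ^ 2) * (1 - q * Q / x) * (1 - x * Q / (M * q ^ 2)) *
          (1 - M * q ^ 3 * Q)) - 1) := by
  have e1 : (1 - q * Q / x) = (x - q * Q) / x := by field_simp
  have e2 : (1 - x / (M * q ^ 3)) = (M * q ^ 3 - x) / (M * q ^ 3) := by field_simp
  have e3 : (1 - x / (M * q ^ 2)) = (M * q ^ 2 - x) / (M * q ^ 2) := by field_simp
  have e4 : (1 - x * Q / (M * q ^ 3)) = (M * q ^ 3 - x * Q) / (M * q ^ 3) := by field_simp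
  have e5 : (1 - x * Q / (M * q ^ 2)) = (M * q ^ 2 - x * Q) / (M * q ^ 2) := by field_simp
  have e6 : (1 - M * q ^ 3 / x) = (x - M * q ^ 3) / x := by field_simp
  rw [e1, e2, e3, e4, e5, e6]
  field_simp
  ring

-- All terms share one product of q-shifted factorials; cancelling it leaves a rational identity in
-- `q`, `x`, `M` and `Q = q^(k+1)`, namely `quad_rational_identity`.
set_option maxHeartbeats 1000000 in
lemma quadCert_succ {q x M : K} {k : ℕ} (hq : q ≠ 0) (hx : x ≠ 0) (hM : M ≠ 0)
    (h1 : 1 - q ^ (2 * (k + 1)) ≠ 0) (h2 : x - q ^ (k + 2) ≠ 0)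
    (h3 : ∀ i ≤ k + 2, M * q ^ 3 - x * q ^ i ≠ 0) (h4 : ∀ i ≤ k + 2, 1 - M * q ^ (i + 2) ≠ 0) :
    x * (1 - M * q ^ 2 / x) * (1 - M * q ^ 3 / x) * quadTerm q x (M * q ^ 2) (k + 1) -
        (1 - M * q ^ 2) * (1 - M * q ^ 3) * quadTerm q x M (k + 1) =
      quadCert q x M (k + 1) - quadCert q x M k := by
  obtain ⟨Q, hQd⟩ : ∃ Q, Q = q ^ (k + 1) := ⟨_, rfl⟩
  have hQk : q ^ k = Q / q := by rw [hQd, pow_succ]; field_simp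
  have hQ : Q ≠ 0 := hQd ▸ pow_ne_zero _ hq
  have g1 : 1 - Q ^ 2 ≠ 0 := by rw [hQd]; convert h1 using 2; ring
  have g2 : x - q * Q ≠ 0 := by rw [hQd]; convert h2 using 2; ring
  have g3 : M * q ^ 3 - x ≠ 0 := by simpa using h3 0 (by omega)
  have g8 : M * q ^ 3 - x * Q ≠ 0 := by rw [hQd]; exact h3 (k + 1) (by omega)
  have g3' : M * q ^ 2 - x ≠ 0 := fun h => h3 1 (by omega) (by linear_combination q * h)
  have g3'' : M * q ^ 2 - x * Q ≠ 0 := fun h =>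
    h3 (k + 2) le_rfl (by rw [pow_succ q (k + 1), ← hQd]; linear_combination q * h)
  have g4 : 1 - M * q ^ 3 * Q ≠ 0 := by rw [hQd]; convert h4 (k + 2) le_rfl using 2; ring
  have g5 : 1 - M * q ^ 2 ≠ 0 := h4 0 (by omega)
  have g6 : 1 - M * q ^ 3 ≠ 0 := h4 1 (by omega)
  have g7 : 1 - M * q ^ 2 * Q ≠ 0 := by rw [hQd]; convert h4 (k + 1) (by omega) using 2; ring
  have g9 : x - M * q ^ 3 ≠ 0 := fun h => g3 (by linear_combination -h)
  have key := quad_rational_identity hq hx hM hQ g1 g2 g3 g3' g3'' g4 g5 g6 g8 g9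
  have f1 : 1 - M * q ^ 3 / x ≠ 0 := by
    rw [show 1 - M * q ^ 3 / x = (x - M * q ^ 3) / x by field_simp]; exact div_ne_zero g9 hx
  have f2 : 1 - x * Q / (M * q ^ 3) ≠ 0 := by
    rw [show 1 - x * Q / (M * q ^ 3) = (M * q ^ 3 - x * Q) / (M * q ^ 3) by field_simp]
    exact div_ne_zero g8 (by positivity)
  have pY : qPoch (M * q ^ 2 * q ^ 3 / x) (q ^ 2) (k + 1) =
      qPoch (M * q ^ 3 / x) (q ^ 2) (k + 1) *
        ((1 - M * q ^ 3 / x * Q ^ 2) / (1 - M * q ^ 3 / x)) := by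
    rw [← mul_div_assoc, eq_div_iff f1]
    have := (qPoch_succ' (M * q ^ 3 / x) (q ^ 2) (k + 1)).symm.trans (qPoch_succ _ _ _)
    rw [show M * q ^ 2 * q ^ 3 / x = M * q ^ 3 / x * q ^ 2 by ring, mul_comm, this, hQd]
    ring
  have pZ : qPoch (1 / M) (q ^ 2) (k + 1) =
      qPoch (1 / M) (q ^ 2) k * (1 - Q ^ 2 / (M * q ^ 2)) := by
    rw [qPoch_succ, ← pow_mul, mul_comm 2 k, pow_mul, hQk]
    field_simp
  have pZ' : qPoch (1 / (M * q ^ 2)) (q ^ 2) (k + 1) =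
      qPoch (1 / M) (q ^ 2) k * (1 - 1 / (M * q ^ 2)) := by
    rw [qPoch_succ', mul_comm, show 1 / (M * q ^ 2) * q ^ 2 = 1 / M by field_simp]
  have p1 : qPoch (q ^ 2) (q ^ 2) (k + 1) = qPoch (q ^ 2) (q ^ 2) k * (1 - Q ^ 2) := by
    rw [qPoch_succ, hQd]; ring
  have p2 : qPoch (q ^ 2 / x) q (k + 1) = qPoch (q ^ 2 / x) q k * (1 - q * Q / x) := by
    rw [qPoch_succ, hQd]; ring
  have p3 : qPoch (x / (M * q)) q (k + 1) =
      qPoch (x / (M * q)) q k * (1 - x * Q / (M * q ^ 2)) := by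
    rw [qPoch_succ, hQk]; field_simp
  have p3' : qPoch (x / (M * q ^ 2 * q)) q (k + 1) = qPoch (x / (M * q)) q k *
      ((1 - x / (M * q ^ 3)) * (1 - x / (M * q ^ 2)) / (1 - x * Q / (M * q ^ 3))) := by
    rw [← mul_div_assoc, eq_div_iff f2]
    have := (qPoch_succ (x / (M * q ^ 2 * q)) q (k + 1)).symm.trans (qPoch_succ' _ _ _)
    rw [qPoch_succ' (x / (M * q ^ 2 * q) * q), show x / (M * q ^ 2 * q) * q * q = x / (M * q) by field_simp,
      show x / (M * q ^ 2 * q) * q = x / (M * q ^ 2) by field_simp, ← hQd,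
      show x / (M * q ^ 2 * q) * Q = x * Q / (M * q ^ 3) by field_simp] at this
    rw [this, show M * q ^ 2 * q = M * q ^ 3 by ring]
    ring
  have p4 : qPoch (M * q ^ 2) q (k + 1) =
      qPoch (M * q ^ 2) q (k + 2) * (1 - M * q ^ 2 * Q)⁻¹ := by
    rw [qPoch_succ _ _ (k + 1), ← hQd, mul_inv_cancel_right₀ g7]
  have p4' : qPoch (M * q ^ 2 * q ^ 2) q (k + 1) = qPoch (M * q ^ 2) q (k + 2) *
      ((1 - M * q ^ 3 * Q) / ((1 - M * q ^ 2) * (1 - M * q ^ 3))) := by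
    rw [← mul_div_assoc, eq_div_iff (mul_ne_zero g5 g6)]
    have := (qPoch_succ' (M * q ^ 2) q (k + 2)).symm.trans (qPoch_succ _ _ _)
    rw [qPoch_succ', pow_succ q (k + 1), ← hQd,
      show M * q ^ 2 * q * q = M * q ^ 2 * q ^ 2 by ring,
      show M * q ^ 2 * q = M * q ^ 3 by ring] at this
    linear_combination this
  have p4'' : qPoch (M * q ^ 2) q (k + 1 + 2) =
      qPoch (M * q ^ 2) q (k + 2) * (1 - M * q ^ 3 * Q) := by
    rw [show k + 1 + 2 = k + 2 + 1 by ring, qPoch_succ, hQd]; ring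
  have pX : qPoch x (q ^ 2) (k + 1 + 1) = qPoch x (q ^ 2) (k + 1) * (1 - x * Q ^ 2) := by
    rw [qPoch_succ, hQd]; ring
  have pY'' : qPoch (M * q ^ 3 / x) (q ^ 2) (k + 1 + 1) =
      qPoch (M * q ^ 3 / x) (q ^ 2) (k + 1) * (1 - M * q ^ 3 / x * Q ^ 2) := by
    rw [qPoch_succ, hQd]; ring
  have pW : qPoch q q (k + 1 + 1) = qPoch q q (k + 1) * (1 - q * Q) := by
    rw [qPoch_succ, hQd]
  have pq : q ^ (3 * (k + 1) + 1) = q * Q ^ 3 := by rw [hQd]; ring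
  simp only [quadTerm, quadCert]
  rw [pY, pZ, pZ', p1, p2, p3, p3', p4, p4', p4'', pX, pY'', pW, zpow_neg_choose_succ hq, ← hQd, pq]
  generalize qPoch x (q ^ 2) (k + 1) = X at *
  generalize qPoch (M * q ^ 3 / x) (q ^ 2) (k + 1) = Y at *
  generalize qPoch (1 / M) (q ^ 2) k = Z at *
  generalize qPoch q q (k + 1) = W at *
  generalize q ^ (-((k + 1).choose 2 : ℤ)) = E at *
  generalize qPoch (q ^ 2) (q ^ 2) k = D1 at *
  generalize qPoch (q ^ 2 / x) q k = D2 at *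
  generalize qPoch (x / (M * q)) q k = D3 at *
  generalize qPoch (M * q ^ 2) q (k + 2) = D4 at *
  have := congrArg (fun y => X * Y * Z * W * E / (D1 * D2 * D3 * D4) * y) key
  convert this using 1
  · simp only [div_eq_mul_inv, mul_inv, inv_inv]; ring
  · simp only [div_eq_mul_inv, mul_inv]; ring

lemma quadCert_zero {q x M : K} (hq : q ≠ 0) (hx : x ≠ 0) (hM : M ≠ 0) (h1 : 1 - M * q ^ 2 ≠ 0)
    (h2 : 1 - M * q ^ 3 ≠ 0) (h3 : M * q ^ 3 - x ≠ 0) :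
    x * (1 - M * q ^ 2 / x) * (1 - M * q ^ 3 / x) * quadTerm q x (M * q ^ 2) 0 -
        (1 - M * q ^ 2) * (1 - M * q ^ 3) * quadTerm q x M 0 = quadCert q x M 0 := by
  have e : 1 - x / (M * q ^ 3) = (M * q ^ 3 - x) / (M * q ^ 3) := by field_simp
  have h2' : 1 - M * q ^ 2 * q ≠ 0 := by convert h2 using 2; ring
  simp [quadTerm, quadCert, qPoch_succ, e]
  field_simp
  ring

/-- `quadCert` telescopes; `quadCert_zero` amounts to a zero certificate at index `-1`. -/
lemma sum_quadTerm_sub {q x M : K} {k : ℕ} (hq : q ≠ 0) (hx : x ≠ 0) (hM : M ≠ 0)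
    (h1 : ∀ i < k, 1 - q ^ (2 * (i + 1)) ≠ 0) (h2 : ∀ i < k, x - q ^ (i + 2) ≠ 0)
    (h3 : ∀ i ≤ k + 1, M * q ^ 3 - x * q ^ i ≠ 0) (h4 : ∀ i ≤ k + 1, 1 - M * q ^ (i + 2) ≠ 0) :
    x * (1 - M * q ^ 2 / x) * (1 - M * q ^ 3 / x) *
          ∑ i ∈ Finset.range (k + 1), quadTerm q x (M * q ^ 2) i -
        (1 - M * q ^ 2) * (1 - M * q ^ 3) * ∑ i ∈ Finset.range (k + 1), quadTerm q x M i =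
      quadCert q x M k := by
  induction k with
  | zero =>
    simpa using quadCert_zero hq hx hM (h4 0 (by omega)) (h4 1 (by omega))
      (by simpa using h3 0 (by omega))
  | succ k ih =>
    have e1 := ih (fun i hi => h1 i (by omega)) (fun i hi => h2 i (by omega))
      (fun i hi => h3 i (by omega)) (fun i hi => h4 i (by omega))
    have e2 := quadCert_succ (k := k) hq hx hM (h1 k (by omega)) (h2 k (by omega))
      (fun i hi => h3 i (by omega)) (fun i hi => h4 i (by omega))
    rw [Finset.sum_range_succ _ (k + 1), Finset.sum_range_succ _ (k + 1)]
    linear_combination e1 + e2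

lemma quadTerm_eq_zero {q x : K} {N k : ℕ} (hq : q ≠ 0) (hk : N < k) :
    quadTerm q x (q ^ (2 * N)) k = 0 := by
  have : qPoch (1 / q ^ (2 * N)) (q ^ 2) k = 0 :=
    qPoch_eq_zero N hk (by rw [← pow_mul]; field_simp)
  rw [quadTerm, this]
  simp

lemma quadCert_eq_zero {q x : K} {N k : ℕ} (hq : q ≠ 0) (hk : N < k) :
    quadCert q x (q ^ (2 * N)) k = 0 := by
  have : qPoch (1 / q ^ (2 * N)) (q ^ 2) k = 0 :=
    qPoch_eq_zero N hk (by rw [← pow_mul]; field_simp)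
  rw [quadCert, this]
  simp

lemma sum_quadTerm_one {q x : K} (hq : q ≠ 0) (hx : x ≠ 0) (h1 : 1 - q ^ 2 ≠ 0)
    (h4 : 1 - q ^ 4 ≠ 0) (h2 : x - q ^ 2 ≠ 0) (h3 : x - q ^ 3 ≠ 0) :
    ∑ k ∈ Finset.range 2, quadTerm q x (q ^ 2) k =
      qPoch q q 3 / (x ^ 1 * qPoch (q ^ 2 / x) q 2) := by
  have h3' : q ^ 3 - x ≠ 0 := fun h => h3 (by linear_combination -h)
  have e1 : 1 - q ^ 2 / x = (x - q ^ 2) / x := by field_simp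
  have e2 : 1 - q ^ 2 / x * q = (x - q ^ 3) / x := by field_simp
  have e3 : 1 - x / (q ^ 2 * q) = (q ^ 3 - x) / q ^ 3 := by field_simp
  have e4 : 1 - q ^ 2 * q ^ 2 ≠ 0 := by convert h4 using 2; ring
  simp [quadTerm, qPoch_succ, Finset.sum_range_succ, e1, e2, e3]
  field_simp
  ring

/-- A terminating quadratic summation. -/
theorem sum_quadTerm {q x : K} (hq : q ≠ 0) (hx : x ≠ 0) (hq1 : ∀ i, 0 < i → q ^ i ≠ 1) (N : ℕ)
    (hxq : ∀ m, 2 ≤ m → m ≤ 2 * N + 1 → x ≠ q ^ m) :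
    ∑ k ∈ Finset.range (N + 1), quadTerm q x (q ^ (2 * N)) k =
      qPoch q q (2 * N + 1) / (x ^ N * qPoch (q ^ 2 / x) q (2 * N)) := by
  have hq1' : ∀ i, 0 < i → 1 - q ^ i ≠ 0 := fun i hi h => hq1 i hi (by linear_combination -h)
  rcases Nat.eq_zero_or_pos N with rfl | hN
  · simp [quadTerm, qPoch_succ]
  -- The step from `N = 0` to `N = 1` would need `x ≠ q` (the third hypothesis of `sum_quadTerm_sub`
  -- at `i = 2`), but `x = q` is used later; hence the base case `N = 1`.
  induction N, hN using Nat.le_induction with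
  | base =>
    exact sum_quadTerm_one hq hx (hq1' 2 (by omega)) (hq1' 4 (by omega))
      (sub_ne_zero.2 (hxq 2 (by omega) (by omega))) (sub_ne_zero.2 (hxq 3 (by omega) (by omega)))
  | succ N hN ih =>
    have hS := ih fun m h2 hm => hxq m h2 (by omega)
    have hM : q ^ (2 * N) ≠ 0 := pow_ne_zero _ hq
    have key := sum_quadTerm_sub (q := q) (x := x) (M := q ^ (2 * N)) (k := N + 1) hq hx hM
      (fun i _ => hq1' _ (by omega))
      (fun i hi => sub_ne_zero.2 (hxq _ (by omega) (by omega)))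
      (fun i hi h => hxq (2 * N + 3 - i) (by omega) (by omega) (by
        apply mul_right_cancel₀ (pow_ne_zero i hq)
        rw [← pow_add, show 2 * N + 3 - i + i = 2 * N + 3 by omega, pow_add]
        linear_combination -h))
      (fun i hi => by rw [← pow_add]; exact hq1' _ (by omega))
    -- At index `N + 1` the term for `M = q^(2N)` and the certificate both contain `(q^(-2N);
    -- q²)_(N+1) = 0`, so `key` becomes a recurrence from `N` to `N + 1`.
    rw [quadCert_eq_zero hq (Nat.lt_succ_self N), Finset.sum_range_succ (quadTerm q x (q ^ (2 * N))),
      quadTerm_eq_zero hq (Nat.lt_succ_self N), add_zero, hS, ← pow_add] at key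
    rw [show 2 * (N + 1) = 2 * N + 1 + 1 by ring, qPoch_succ (q ^ 2 / x) q (2 * N + 1),
      qPoch_succ (q ^ 2 / x) q (2 * N), qPoch_succ q q (2 * N + 1 + 1),
      qPoch_succ q q (2 * N + 1)]
    have n1 : 1 - q ^ 2 / x * q ^ (2 * N) ≠ 0 := fun h =>
      hxq (2 * N + 2) (by omega) (by omega) (by field_simp at h; linear_combination h)
    have n2 : 1 - q ^ 2 / x * q ^ (2 * N + 1) ≠ 0 := fun h =>
      hxq (2 * N + 3) (by omega) (by omega) (by field_simp at h; linear_combination h)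
    have n3 : qPoch (q ^ 2 / x) q (2 * N) ≠ 0 := qPoch_ne_zero fun i hi h =>
      hxq (i + 2) (by omega) (by omega) (by field_simp at h; linear_combination h)
    rw [show 1 - q ^ (2 * N + 2) / x = 1 - q ^ 2 / x * q ^ (2 * N) by ring,
      show 1 - q ^ (2 * N) * q ^ 3 / x = 1 - q ^ 2 / x * q ^ (2 * N + 1) by ring] at key
    rw [eq_div_iff (by positivity)]
    have key' := sub_eq_zero.1 key
    rw [← mul_div_assoc, eq_div_iff (mul_ne_zero (pow_ne_zero _ hx) n3)] at key'
    rw [show 2 * N + 2 = 2 * N + 1 + 1 by ring] at key'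
    linear_combination key'

end QuadraticSum

/-! ### Specialization of fractions with surviving denominators. -/

section Specialization

set_option linter.unusedSectionVars false

variable {A K L : Type*} [CommRing A] [Field K] [Algebra A K] [IsFractionRing A K]
  [Field L]

/-- The element `f` of the fraction field of `A` specializes to `v` under `φ : A →+* L`:
it is a fraction whose denominator is not killed by `φ` and whose image is `v`. -/
def SpecializesTo (φ : A →+* L) (f : K) (v : L) : Prop :=
  ∃ N D : A, φ D ≠ 0 ∧ f = algebraMap A K N / algebraMap A K D ∧ v = φ N / φ D

namespace SpecializesTo

variable {φ : A →+* L} {f g : K} {v w : L}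

lemma algebraMap_ne_zero {D : A} (h : φ D ≠ 0) : algebraMap A K D ≠ 0 := by
  intro h0
  rw [IsFractionRing.to_map_eq_zero_iff] at h0
  exact h (by rw [h0, map_zero])

lemma of_algebraMap (φ : A →+* L) (x : A) : SpecializesTo φ (algebraMap A K x) (φ x) :=
  ⟨x, 1, by simp, by simp, by simp⟩

lemma one (φ : A →+* L) : SpecializesTo φ (1 : K) 1 := by
  simpa using of_algebraMap (K := K) φ 1

lemma zero (φ : A →+* L) : SpecializesTo φ (0 : K) 0 := by
  simpa using of_algebraMap (K := K) φ 0

lemma add (hf : SpecializesTo φ f v) (hg : SpecializesTo φ g w) :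
    SpecializesTo φ (f + g) (v + w) := by
  obtain ⟨N, D, hD, rfl, rfl⟩ := hf
  obtain ⟨N', D', hD', rfl, rfl⟩ := hg
  have h1 := algebraMap_ne_zero (K := K) hD
  have h2 := algebraMap_ne_zero (K := K) hD'
  refine ⟨N * D' + D * N', D * D', by simp [hD, hD'], ?_, ?_⟩
  · simp [div_add_div _ _ h1 h2]
  · simp [div_add_div _ _ hD hD']

lemma mul (hf : SpecializesTo φ f v) (hg : SpecializesTo φ g w) :
    SpecializesTo φ (f * g) (v * w) := by
  obtain ⟨N, D, hD, rfl, rfl⟩ := hf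
  obtain ⟨N', D', hD', rfl, rfl⟩ := hg
  exact ⟨N * N', D * D', by simp [hD, hD'], by simp [div_mul_div_comm],
    by simp [div_mul_div_comm]⟩

lemma neg (hf : SpecializesTo φ f v) : SpecializesTo φ (-f) (-v) := by
  simpa using (of_algebraMap (K := K) φ (-1)).mul hf

lemma sub (hf : SpecializesTo φ f v) (hg : SpecializesTo φ g w) :
    SpecializesTo φ (f - g) (v - w) := by
  simpa [sub_eq_add_neg] using hf.add hg.neg

lemma inv (hf : SpecializesTo φ f v) (hv : v ≠ 0) : SpecializesTo φ f⁻¹ v⁻¹ := by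
  obtain ⟨N, D, hD, rfl, rfl⟩ := hf
  exact ⟨D, N, fun h => hv (by rw [h, zero_div]), by simp, by simp⟩

lemma div (hf : SpecializesTo φ f v) (hg : SpecializesTo φ g w) (hw : w ≠ 0) :
    SpecializesTo φ (f / g) (v / w) := by
  simpa [div_eq_mul_inv] using hf.mul (hg.inv hw)

lemma pow (hf : SpecializesTo φ f v) (n : ℕ) : SpecializesTo φ (f ^ n) (v ^ n) := by
  induction n with
  | zero => simpa using one φ
  | succ n ih => simpa [pow_succ] using ih.mul hf

lemma zpow (hf : SpecializesTo φ f v) (hv : v ≠ 0) (n : ℤ) :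
    SpecializesTo φ (f ^ n) (v ^ n) := by
  obtain ⟨m, rfl | rfl⟩ := n.eq_nat_or_neg
  · simpa using hf.pow m
  · simpa using (hf.pow m).inv (pow_ne_zero m hv)

lemma sum {ι : Type*} {s : Finset ι} {f : ι → K} {v : ι → L}
    (h : ∀ i ∈ s, SpecializesTo φ (f i) (v i)) :
    SpecializesTo φ (∑ i ∈ s, f i) (∑ i ∈ s, v i) := by
  classical
  induction s using Finset.induction_on with
  | empty => simpa using zero φ
  | insert a s ha ih =>
    rw [Finset.sum_insert ha, Finset.sum_insert ha]
    exact (h a (by simp)).add (ih fun i hi => h i (by simp [hi]))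

lemma prod {ι : Type*} {s : Finset ι} {f : ι → K} {v : ι → L}
    (h : ∀ i ∈ s, SpecializesTo φ (f i) (v i)) :
    SpecializesTo φ (∏ i ∈ s, f i) (∏ i ∈ s, v i) := by
  classical
  induction s using Finset.induction_on with
  | empty => simpa using one φ
  | insert a s ha ih =>
    rw [Finset.prod_insert ha, Finset.prod_insert ha]
    exact (h a (by simp)).mul (ih fun i hi => h i (by simp [hi]))

/-- Any representation of `f` as a fraction is compatible with a specialization of `f`. -/
lemma map_num_eq (hf : SpecializesTo φ f v) {U V : A} (hV : V ≠ 0)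
    (h : f = algebraMap A K U / algebraMap A K V) : φ U = v * φ V := by
  obtain ⟨N, D, hD, h', rfl⟩ := hf
  have hV' : algebraMap A K V ≠ 0 := by rwa [Ne, IsFractionRing.to_map_eq_zero_iff]
  rw [h, div_eq_div_iff hV' (algebraMap_ne_zero hD), ← map_mul, ← map_mul] at h'
  have := congrArg φ (IsFractionRing.injective A K h')
  simp only [map_mul] at this
  field_simp
  exact this

/-- Carries an identity in `K` over to `L`: the specializations of its two sides must agree. -/
lemma unique (hf : SpecializesTo φ f v) (hf' : SpecializesTo φ f w) : v = w := by
  obtain ⟨N, D, hD, h, rfl⟩ := hf'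
  rw [hf.map_num_eq (by rintro rfl; simp at hD) h, mul_div_cancel_right₀ _ hD]

lemma qPoch {q x : K} {κ ξ : L} (hx : SpecializesTo φ x ξ) (hq : SpecializesTo φ q κ) (k : ℕ) :
    SpecializesTo φ (qPoch x q k) (qPoch ξ κ k) :=
  prod fun _ _ => (one φ).sub (hx.mul (hq.pow _))

lemma qInt {q : K} {κ : L} (hq : SpecializesTo φ q κ) (k : ℕ) :
    SpecializesTo φ (qInt q k) (qInt κ k) :=
  sum fun _ _ => hq.pow _

lemma cTermParam {a q : K} {α κ : L} {k : ℕ} (ha : SpecializesTo φ a α)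
    (hq : SpecializesTo φ q κ) (hα : α ≠ 0) (hκ : κ ≠ 0) (h1 : ∀ i < k, α * κ ^ (i + 1) ≠ 1)
    (h2 : ∀ i < k, κ ^ (i + 1) ≠ α) (h3 : ∀ i < k, κ ^ (2 * (i + 1)) ≠ 1) :
    SpecializesTo φ (cTermParam a q k) (cTermParam α κ k) := by
  have haq := ha.mul hq
  have hqa := hq.div ha hα
  have hq2 := hq.pow 2
  refine (hq.qInt _).mul ((((haq.qPoch hq2 k).mul (hqa.qPoch hq2 k)).mul
    (hq.qPoch hq2 k)).mul (hq.zpow hκ _) |>.div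
      (((haq.qPoch hq k).mul (hqa.qPoch hq k)).mul (hq2.qPoch hq2 k)) ?_)
  refine mul_ne_zero (mul_ne_zero ?_ ?_) ?_ <;> refine qPoch_ne_zero fun i hi h => ?_
  · exact h1 i hi (by rw [pow_succ]; linear_combination -h)
  · field_simp at h
    exact h2 i hi (by rw [pow_succ]; linear_combination -h)
  · exact h3 i hi (by rw [mul_add, pow_add, pow_mul]; linear_combination -h)

lemma truncSquare {c : ℕ → K} {γ : ℕ → L} {n : ℕ}
    (h : ∀ k < n, SpecializesTo φ (c k) (γ k)) :
    SpecializesTo φ (truncSquare c n) (truncSquare γ n) := by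
  refine sum fun k hk => sum fun j hj => ?_
  simp only [Finset.mem_range] at hk hj
  exact (h _ (by omega)).mul (h _ (by omega))

lemma quadTerm {q x M : K} {κ ξ μ : L} {k : ℕ} (hq : SpecializesTo φ q κ)
    (hx : SpecializesTo φ x ξ) (hM : SpecializesTo φ M μ) (hκ : κ ≠ 0) (hξ : ξ ≠ 0) (hμ : μ ≠ 0)
    (h : _root_.qPoch (κ ^ 2) (κ ^ 2) k * _root_.qPoch (κ ^ 2 / ξ) κ k * _root_.qPoch (ξ / (μ * κ)) κ k *
      _root_.qPoch (μ * κ ^ 2) κ k ≠ 0) :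
    SpecializesTo φ (quadTerm q x M k) (quadTerm κ ξ μ k) := by
  have hq2 := hq.pow 2
  exact (((one φ).sub (hq.pow _)).mul (((((hx.qPoch hq2 k).mul
    (((hM.mul (hq.pow 3)).div hx hξ).qPoch hq2 k)).mul
      (((one φ).div hM hμ).qPoch hq2 k)).mul (hq.qPoch hq k)).mul (hq.zpow hκ _))).div
    ((((hq2.qPoch hq2 k).mul ((hq2.div hx hξ).qPoch hq k)).mul
      ((hx.div (hM.mul hq) (mul_ne_zero hμ hκ)).qPoch hq k)).mul
        ((hM.mul hq2).qPoch hq k)) h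

end SpecializesTo

end Specialization

/-! ### Sums of the terms at `a = q^n` and at roots of unity. -/

section TermEvaluations

variable {K : Type*} [Field K]

lemma cTermParam_inv (a q : K) (k : ℕ) : cTermParam a⁻¹ q k = cTermParam a q k := by
  simp only [cTermParam, div_inv_eq_mul, ← div_eq_inv_mul, mul_comm q a,
    mul_comm (qPoch (a * q) _ k)]

lemma cTermParam_one (q : K) : cTermParam 1 q = cTerm q := by
  funext k
  simp only [cTermParam, cTerm, one_mul, div_one]
  ring

/-- With `x = q` the factor `(q²/x; q)_k` cancels `(q; q)_k` in the numerator; `M = q^(2N)` plays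
the role of `a / q`. -/
lemma one_sub_mul_cTermParam_pow {q : K} (hq : q ≠ 0) (hq1 : ∀ i, 0 < i → q ^ i ≠ 1) (N k : ℕ) :
    (1 - q) * cTermParam (q ^ (2 * N + 1)) q k = quadTerm q q (q ^ (2 * N)) k := by
  have hP : qPoch q q k ≠ 0 := qPoch_ne_zero fun i _ h =>
    hq1 (i + 1) (by omega) (by rw [pow_succ]; linear_combination -h)
  rw [cTermParam, quadTerm, ← mul_assoc, one_sub_mul_qInt,
    show q ^ (2 * N) * q ^ 3 / q = q ^ (2 * N + 1) * q by field_simp; ring,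
    show q / q ^ (2 * N + 1) = 1 / q ^ (2 * N) by rw [pow_succ]; field_simp,
    show q ^ 2 / q = q by field_simp,
    show q / (q ^ (2 * N) * q) = 1 / q ^ (2 * N) by field_simp,
    show q ^ (2 * N) * q ^ 2 = q ^ (2 * N + 1) * q by ring, ← mul_div_assoc]
  refine (mul_div_mul_right _ _ hP).symm.trans ?_
  congr 1 <;> ring

lemma sum_cTermParam_pow {q : K} (hq : q ≠ 0) (hq1 : ∀ i, 0 < i → q ^ i ≠ 1) (N : ℕ) :
    ∑ k ∈ Finset.range (N + 1), cTermParam (q ^ (2 * N + 1)) q k =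
      qInt q (2 * N + 1) / q ^ N := by
  have h1 : 1 - q ≠ 0 := fun h => hq1 1 one_pos (by linear_combination -h)
  apply mul_left_cancel₀ h1
  have hP : qPoch q q (2 * N) ≠ 0 := qPoch_ne_zero fun i _ h =>
    hq1 (i + 1) (by omega) (by rw [pow_succ]; linear_combination -h)
  rw [Finset.mul_sum, Finset.sum_congr rfl fun k _ => one_sub_mul_cTermParam_pow hq hq1 N k,
    sum_quadTerm hq hq hq1 N fun m hm _ h => hq1 (m - 1) (by omega) ?_, ← mul_div_assoc,
    one_sub_mul_qInt, show q ^ 2 / q = q by field_simp, qPoch_succ]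
  · field_simp
    ring
  · apply mul_right_cancel₀ hq
    rw [← pow_succ, show m - 1 + 1 = m by omega, one_mul, ← h]

/-- At a primitive root of unity of odd order `2N+1 > 1` the first `N+1` terms sum to zero. -/
lemma sum_cTermParam_rootOfUnity {a z : K} {N : ℕ} (hN : 0 < N) (hz : IsPrimitiveRoot z (2 * N + 1))
    (ha : a ≠ 0) (ha1 : ∀ j, ¬ (2 * N + 1) ∣ j → a * z ^ j ≠ 1)
    (ha2 : ∀ j, ¬ (2 * N + 1) ∣ j → z ^ j ≠ a) :
    ∑ k ∈ Finset.range (N + 1), cTermParam a z k = 0 := by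
  have hz0 : z ≠ 0 := hz.ne_zero (by omega)
  have hz1 : z ^ (2 * N + 1) = 1 := hz.pow_eq_one
  have hndvd : ∀ j, 0 < j → j < 2 * N + 1 → ¬ (2 * N + 1) ∣ j := fun j h0 h h' =>
    absurd (Nat.le_of_dvd h0 h') (by omega)
  have hzj : ∀ j, ¬ (2 * N + 1) ∣ j → 1 - z ^ j ≠ 0 := fun j hj h =>
    hj ((hz.pow_eq_one_iff_dvd j).1 (by linear_combination -h))
  have h1z : 1 - z ≠ 0 := by simpa using hzj 1 (hndvd 1 one_pos (by omega))
  -- Since `z^(2N+1) = 1`, here `x` is `a z` and `M` is `z⁻¹`. The exponent `2N + 2` lies outside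
  -- the range of `m` for which the generic summation requires `x ≠ q^m`, so any constant `a` is
  -- allowed.
  have hterm : ∀ k ∈ Finset.range (N + 1), (1 - z) * cTermParam a z k =
      quadTerm z (a * z ^ (2 * N + 2)) (z ^ (2 * N)) k := by
    intro k hk
    rw [Finset.mem_range] at hk
    have hP : qPoch z z k ≠ 0 := qPoch_ne_zero fun i hi h =>
      hzj (i + 1) (hndvd _ (by omega) (by omega)) (by rw [pow_succ]; linear_combination h)
    rw [cTermParam, quadTerm, ← mul_assoc, one_sub_mul_qInt, pow_succ z (2 * N + 1), hz1, one_mul,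
      show z ^ (2 * N) * z ^ 3 = z ^ (2 * N + 1) * z ^ 2 by ring,
      show z ^ (2 * N) * z ^ 2 = z ^ (2 * N + 1) * z by ring, ← pow_succ z (2 * N), hz1, one_mul, one_mul,
      show z ^ 2 / (a * z) = z / a by field_simp, div_one,
      show 1 / z ^ (2 * N) = z by
        rw [div_eq_iff (pow_ne_zero _ hz0), ← hz1]; ring, ← mul_div_assoc]
    refine (mul_div_mul_right _ _ hP).symm.trans ?_
    congr 1 <;> ring
  apply mul_left_cancel₀ h1z
  rw [Finset.mul_sum, Finset.sum_congr rfl hterm, mul_zero]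
  -- specialize the generic summation over `K(q)` to `q = z`
  let φ : K[X] →+* K := evalRingHom z
  have sq : SpecializesTo φ (RatFunc.X : RatFunc K) z := by
    simpa [φ] using SpecializesTo.of_algebraMap (K := RatFunc K) φ X
  have sa : SpecializesTo φ (RatFunc.C a : RatFunc K) a := by
    simpa [φ] using SpecializesTo.of_algebraMap (K := RatFunc K) φ (C a)
  have sx := sa.mul (sq.pow (2 * N + 2))
  have hX0 : (RatFunc.X : RatFunc K) ≠ 0 := RatFunc.X_ne_zero
  have hpow : ∀ (c : K) (i j : ℕ), i ≠ j → c ≠ 0 →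
      (RatFunc.C c : RatFunc K) * RatFunc.X ^ i ≠ RatFunc.X ^ j := by
    intro c i j hij hc h
    rw [← RatFunc.algebraMap_C, ← RatFunc.algebraMap_X, ← map_pow, ← map_pow, ← map_mul] at h
    have := congrArg natDegree (RatFunc.algebraMap_injective K h)
    rw [natDegree_C_mul_X_pow _ _ hc, natDegree_X_pow] at this
    exact hij this
  have hxne : (RatFunc.C a : RatFunc K) * RatFunc.X ^ (2 * N + 2) ≠ 0 :=
    mul_ne_zero (by simpa using ha) (pow_ne_zero _ hX0)
  have key := sum_quadTerm (q := (RatFunc.X : RatFunc K)) hX0 hxne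
    (fun i hi h => hpow 1 i 0 (by omega) one_ne_zero (by simpa using h)) N
    (fun m _ hm => hpow a _ _ (by omega) ha)
  have s1 : SpecializesTo φ (∑ k ∈ Finset.range (N + 1), quadTerm (RatFunc.X : RatFunc K)
      (RatFunc.C a * RatFunc.X ^ (2 * N + 2)) (RatFunc.X ^ (2 * N)) k)
      (∑ k ∈ Finset.range (N + 1), quadTerm z (a * z ^ (2 * N + 2)) (z ^ (2 * N)) k) := by
    refine SpecializesTo.sum fun k hk => ?_
    rw [Finset.mem_range] at hk
    refine sq.quadTerm sx (sq.pow _) hz0 (mul_ne_zero ha (pow_ne_zero _ hz0))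
      (pow_ne_zero _ hz0) ?_
    rw [pow_succ z (2 * N + 1), show z ^ (2 * N) * z ^ 2 = z ^ (2 * N + 1) * z by ring,
      ← pow_succ z (2 * N), hz1, one_mul, show z ^ 2 / (a * z) = z / a by field_simp, div_one]
    refine mul_ne_zero (mul_ne_zero (mul_ne_zero ?_ ?_) ?_) ?_ <;>
      refine qPoch_ne_zero fun i hi h => ?_
    · exact hzj (2 * (i + 1)) (hndvd _ (by omega) (by omega))
        (by rw [mul_add, pow_add, pow_mul]; linear_combination h)
    · field_simp at h
      exact ha2 (i + 1) (hndvd _ (by omega) (by omega)) (by rw [pow_succ]; linear_combination -h)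
    · exact ha1 (i + 1) (hndvd _ (by omega) (by omega)) (by rw [pow_succ]; linear_combination -h)
    · exact hzj (i + 1) (hndvd _ (by omega) (by omega)) (by rw [pow_succ]; linear_combination h)
  have hden : (a * z ^ (2 * N + 2)) ^ N * qPoch (z ^ 2 / (a * z ^ (2 * N + 2))) z (2 * N) ≠ 0 := by
    refine mul_ne_zero (pow_ne_zero _ (mul_ne_zero ha (pow_ne_zero _ hz0)))
      (qPoch_ne_zero fun i hi h => ?_)
    rw [pow_succ z (2 * N + 1), hz1, one_mul] at h
    field_simp at h
    exact ha2 (i + 1) (hndvd _ (by omega) (by omega)) (by rw [pow_succ]; linear_combination -h)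
  have s2 := (sq.qPoch sq (2 * N + 1)).div ((sx.pow N).mul
    (((sq.pow 2).div sx (mul_ne_zero ha (pow_ne_zero _ hz0))).qPoch sq (2 * N))) hden
  rw [key] at s1
  -- The closed form has numerator `(q; q)_(2N+1)`, whose last factor `1 - q^(2N+1)` vanishes at
  -- `z`.
  rw [s1.unique s2, qPoch_eq_zero (2 * N) (by omega) (by rw [← hz1]; ring), zero_div]

end TermEvaluations

/-! ### Truncated squares of sequences with vanishing terms. -/

section TruncatedSquare

variable {K : Type*} [Field K]

lemma truncSquare_eq (c : ℕ → K) (n : ℕ) :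
    truncSquare c n = ∑ j ∈ Finset.range n, c j * ∑ l ∈ Finset.range (n - j), c l := by
  rw [truncSquare, Finset.sum_range_diag_flip n fun i j => c i * c j]
  simp only [Finset.mul_sum]

/-- For `j ≤ N` the inner sum has at least `N + 1` terms, so it is already the full sum; for `j > N`
the factor `c j` is zero. -/
lemma truncSquare_eq_sq {c : ℕ → K} {N : ℕ} (h : ∀ k, N < k → k < 2 * N + 1 → c k = 0) :
    truncSquare c (2 * N + 1) = (∑ k ∈ Finset.range (N + 1), c k) ^ 2 := by
  have hs : ∀ m, N + 1 ≤ m → m ≤ 2 * N + 1 →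
      ∑ l ∈ Finset.range m, c l = ∑ l ∈ Finset.range (N + 1), c l := by
    intro m h1 h2
    refine (Finset.sum_subset (Finset.range_subset_range.2 h1) fun k hk hk' => ?_).symm
    simp only [Finset.mem_range] at hk hk'
    exact h k (by omega) (by omega)
  rw [truncSquare_eq, sq, Finset.sum_mul, ← Finset.sum_subset
    (Finset.range_subset_range.2 (show N + 1 ≤ 2 * N + 1 by omega))]
  · refine Finset.sum_congr rfl fun j hj => ?_
    rw [Finset.mem_range] at hj
    rw [hs _ (by omega) (by omega)]
  · intro k hk hk'
    simp only [Finset.mem_range] at hk hk'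
    rw [h k (by omega) (by omega), zero_mul]

/-- If `c` is block-multiplicative of odd period `2N+1`, vanishes in the second half of each block
and sums to zero over the first block, then its truncated square vanishes. -/
lemma truncSquare_eq_zero {c β γ : ℕ → K} {N m : ℕ}
    (hc : ∀ t r, r < 2 * N + 1 → c ((2 * N + 1) * t + r) = β t * γ r)
    (hγ : ∀ r, N < r → r < 2 * N + 1 → γ r = 0) (hs : ∑ r ∈ Finset.range (N + 1), γ r = 0) :
    truncSquare c ((2 * N + 1) * m) = 0 := by
  have part : ∀ t r, r ≤ 2 * N + 1 → ∑ l ∈ Finset.range ((2 * N + 1) * t + r), c l =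
      ∑ l ∈ Finset.range ((2 * N + 1) * t), c l + β t * ∑ i ∈ Finset.range r, γ i := by
    intro t r hr
    rw [Finset.sum_range_add, Finset.mul_sum]
    congr 1
    refine Finset.sum_congr rfl fun i hi => ?_
    rw [Finset.mem_range] at hi
    exact hc t i (by omega)
  have hs' : ∀ r, N < r → r ≤ 2 * N + 1 → ∑ i ∈ Finset.range r, γ i = 0 := by
    intro r h1 h2
    rw [← hs]
    refine (Finset.sum_subset (Finset.range_subset_range.2 h1) fun k hk hk' => ?_).symm
    simp only [Finset.mem_range] at hk hk'
    exact hγ k (by omega) (by omega)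
  have full : ∀ t, ∑ l ∈ Finset.range ((2 * N + 1) * t), c l = 0 := by
    intro t
    induction t with
    | zero => simp
    | succ t ih => rw [mul_add, mul_one, part t _ le_rfl, ih, hs' _ (by omega) le_rfl]; simp
  rw [truncSquare_eq]
  refine Finset.sum_eq_zero fun j hj => ?_
  rw [Finset.mem_range] at hj
  have hjd := Nat.div_add_mod j (2 * N + 1)
  have hr : j % (2 * N + 1) < 2 * N + 1 := Nat.mod_lt _ (by omega)
  have ht : j / (2 * N + 1) < m := Nat.div_lt_of_lt_mul hj
  generalize j / (2 * N + 1) = t at *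
  generalize j % (2 * N + 1) = r at *
  subst hjd
  obtain ⟨s, rfl⟩ := Nat.exists_eq_add_of_lt ht
  -- Here `j = (2N+1)t + r` and `m = t + s + 1`. If `r > N` then `c j = 0`; otherwise the inner sum
  -- has `s` full blocks and `2N + 1 - r > N` further terms, and vanishes.
  rcases Nat.lt_or_ge N r with h | h
  · rw [hc t r hr, hγ r h hr]; simp
  · rw [show (2 * N + 1) * (t + s + 1) - ((2 * N + 1) * t + r) =
      (2 * N + 1) * s + (2 * N + 1 - r) by
        rw [show (2 * N + 1) * (t + s + 1) = (2 * N + 1) * t + ((2 * N + 1) * s + (2 * N + 1)) by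
          ring]; omega, part s _ (by omega), full, hs' _ (by omega) (by omega)]
    simp

end TruncatedSquare

/-! ### Successive ratios of the terms. -/

section BaseTerm

variable {K : Type*} [Field K]

/-- The factor of `cTermParam` that remains after removing `[3k+1]`. -/
def baseTerm (a q : K) (k : ℕ) : K :=
  qPoch (a * q) (q ^ 2) k * qPoch (q / a) (q ^ 2) k * qPoch q (q ^ 2) k *
      q ^ (-((k + 1).choose 2 : ℤ)) /
    (qPoch (a * q) q k * qPoch (q / a) q k * qPoch (q ^ 2) (q ^ 2) k)

lemma cTermParam_eq (a q : K) (k : ℕ) :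
    cTermParam a q k = qInt q (3 * k + 1) * baseTerm a q k := rfl

lemma baseTerm_zero (a q : K) : baseTerm a q 0 = 1 := by simp [baseTerm]

/-- If `q` has odd order `2N + 1`, then `1 - q^(2k+1)` vanishes exactly for `k ≡ N` and `1 -
q^(2k+2)` exactly for `k ≡ 2N`: a zero enters in mid-block and is cancelled at the end of the block.
-/
lemma baseTerm_succ {a q : K} (hq : q ≠ 0) (k : ℕ) :
    baseTerm a q (k + 1) = baseTerm a q k *
      ((1 - a * q ^ (2 * k + 1)) * (1 - q ^ (2 * k + 1) / a) * (1 - q ^ (2 * k + 1)) *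
          (q ^ (k + 1))⁻¹ /
        ((1 - a * q ^ (k + 1)) * (1 - q ^ (k + 1) / a) * (1 - q ^ (2 * k + 2)))) := by
  rw [baseTerm, baseTerm, zpow_neg_choose_succ hq, div_mul_div_comm]
  simp only [qPoch_succ]
  congr 1 <;> ring

lemma baseTerm_eq_zero {a q : K} {N k : ℕ} (hq : q ^ (2 * N + 1) = 1) (hk : N < k) :
    baseTerm a q k = 0 := by
  have : qPoch q (q ^ 2) k = 0 := qPoch_eq_zero N hk (by rw [← hq]; ring)
  simp [baseTerm, this]

end BaseTerm

/-! ### Block structure at a root of unity. -/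

section RootOfUnity

variable {A K L : Type*} [CommRing A] [Field K] [Algebra A K] [IsFractionRing A K] [Field L]
  {φ : A →+* L}

/-- A sequence whose successive ratios specialize periodically, with period `2N+1`, apart from a
factor `z` at position `N` and a factor `z⁻¹` at position `2N` of each block, where `z` specializes
to `0`, specializes blockwise to multiples of the first block. -/
lemma exists_block_specialization {b : ℕ → K} {g : ℕ → L} {z : K} {N : ℕ} (hN : 0 < N)
    (hz : z ≠ 0) (hz0 : SpecializesTo φ z 0) (hb : b 0 = 1) (hg : g 0 = 1)
    (hg0 : ∀ r, N < r → g r = 0)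
    (h1 : ∀ t r, r < 2 * N → r ≠ N → ∃ u v, SpecializesTo φ u v ∧ g (r + 1) = g r * v ∧
      b ((2 * N + 1) * t + r + 1) = b ((2 * N + 1) * t + r) * u)
    (h2 : ∀ t, ∃ u v, SpecializesTo φ u v ∧
      b ((2 * N + 1) * t + N + 1) = b ((2 * N + 1) * t + N) * (z * u))
    (h3 : ∀ t, ∃ u v, SpecializesTo φ u v ∧
      b ((2 * N + 1) * t + 2 * N + 1) * z = b ((2 * N + 1) * t + 2 * N) * u) :
    ∃ β : ℕ → L, ∀ t r, r < 2 * N + 1 →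
      SpecializesTo φ (b ((2 * N + 1) * t + r)) (β t * g r) := by
  have low : ∀ t β, SpecializesTo φ (b ((2 * N + 1) * t)) β → ∀ r, r ≤ N →
      SpecializesTo φ (b ((2 * N + 1) * t + r)) (β * g r) := by
    intro t β hβ r
    induction r with
    | zero => intro _; simpa [hg] using hβ
    | succ r ih =>
      intro hr
      obtain ⟨u, v, hu, hgu, hbu⟩ := h1 t r (by omega) (by omega)
      rw [← add_assoc, hbu, hgu, ← mul_assoc]
      exact (ih (by omega)).mul hu
  -- Past position `N` the factor `z` forces the value zero, so the value of the cofactor need not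
  -- be tracked.
  have high : ∀ t β, SpecializesTo φ (b ((2 * N + 1) * t)) β → ∀ r, N < r → r ≤ 2 * N →
      ∃ w v, SpecializesTo φ w v ∧ b ((2 * N + 1) * t + r) = z * w := by
    intro t β hβ r hr
    induction r, hr using Nat.le_induction with
    | base =>
      intro _
      obtain ⟨u, v, hu, hbu⟩ := h2 t
      exact ⟨_, _, (low t β hβ N le_rfl).mul hu, by rw [Nat.succ_eq_add_one, ← add_assoc, hbu]; ring⟩
    | succ r hr ih =>
      intro hr'
      obtain ⟨w, v, hw, hbw⟩ := ih (by omega)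
      obtain ⟨u, v', hu, -, hbu⟩ := h1 t r (by omega) (by omega)
      exact ⟨_, _, hw.mul hu, by rw [← add_assoc, hbu, hbw]; ring⟩
  have start : ∀ t, ∃ β, SpecializesTo φ (b ((2 * N + 1) * t)) β := by
    intro t
    induction t with
    | zero => exact ⟨1, by simpa [hb] using SpecializesTo.one φ⟩
    | succ t ih =>
      obtain ⟨β, hβ⟩ := ih
      obtain ⟨w, v, hw, hbw⟩ := high t β hβ (2 * N) (by omega) le_rfl
      obtain ⟨u, v', hu, hbu⟩ := h3 t
      -- The `z` gained at position `N` cancels the `z⁻¹` at position `2N`, so the next block starts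
      -- with an element that specializes.
      refine ⟨v * v', ?_⟩
      rw [hbw] at hbu
      rw [show (2 * N + 1) * (t + 1) = (2 * N + 1) * t + 2 * N + 1 by ring,
        mul_right_cancel₀ hz (hbu.trans (show _ = w * u * z by ring))]
      exact hw.mul hu
  choose β hβ using start
  refine ⟨β, fun t r hr => ?_⟩
  rcases Nat.lt_or_ge N r with h | h
  · obtain ⟨w, v, hw, hbw⟩ := high t _ (hβ t) r h (by omega)
    rw [hbw, hg0 r h, mul_zero, ← zero_mul v]
    exact hz0.mul hw
  · exact low t _ (hβ t) r h

/-- A multiple `j` of the order of the specialization of `q`: the factor `1 - q^j` is `1 - q^d`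
times an element with nonzero specialization. -/
lemma exists_one_sub_pow_eq [CharZero L] {q : K} {ζ : L} {d j : ℕ} (hq : SpecializesTo φ q ζ)
    (hζ : ζ ^ d = 1) (hj : 0 < j) (hdj : d ∣ j) :
    ∃ w v, SpecializesTo φ w v ∧ v ≠ 0 ∧ 1 - q ^ j = (1 - q ^ d) * w := by
  obtain ⟨s, rfl⟩ := hdj
  refine ⟨_, _, (hq.pow d).qInt s, ?_, ?_⟩
  · have : s ≠ 0 := by rintro rfl; simp at hj
    simpa [qInt, hζ] using this
  · rw [one_sub_mul_qInt, pow_mul]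

/-- `z` is the common vanishing part of `1 - a q^j` and `1 - q^j / a` over multiples `j` of the
order: `1` for generic `a`, `1 - q^(2N+1)` for `a = 1`. One argument thus serves both parts of the
theorem. -/
lemma specializesTo_truncSquare_zero [CharZero L] {a q z : K} {α ζ ω : L} {N m : ℕ} (hN : 0 < N)
    (hζ : IsPrimitiveRoot ζ (2 * N + 1)) (ha : SpecializesTo φ a α) (hq : SpecializesTo φ q ζ)
    (hα : α ≠ 0) (hα1 : ∀ j, ¬ (2 * N + 1) ∣ j → α * ζ ^ j ≠ 1)
    (hα2 : ∀ j, ¬ (2 * N + 1) ∣ j → ζ ^ j ≠ α) (hq1 : ∀ i, 0 < i → q ^ i ≠ 1) (hz : z ≠ 0)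
    (hzω : SpecializesTo φ z ω)
    (hz1 : ∀ j, 0 < j → (2 * N + 1) ∣ j → ∃ w v, SpecializesTo φ w v ∧ v ≠ 0 ∧
      1 - a * q ^ j = z * w)
    (hz2 : ∀ j, 0 < j → (2 * N + 1) ∣ j → ∃ w v, SpecializesTo φ w v ∧ v ≠ 0 ∧
      1 - q ^ j / a = z * w) :
    SpecializesTo φ (truncSquare (cTermParam a q) ((2 * N + 1) * m)) 0 := by
  have hζ0 : ζ ≠ 0 := hζ.ne_zero (by omega)
  have hζ1 : ζ ^ (2 * N + 1) = 1 := hζ.pow_eq_one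
  have hq0 : q ≠ 0 := by
    rintro rfl
    exact hζ0 (hq.unique (SpecializesTo.zero φ))
  have hζj : ∀ j, ¬ (2 * N + 1) ∣ j → 1 - ζ ^ j ≠ 0 := fun j hj h =>
    hj ((hζ.pow_eq_one_iff_dvd j).1 (by linear_combination -h))
  have hα1' : ∀ j, ¬ (2 * N + 1) ∣ j → 1 - α * ζ ^ j ≠ 0 := fun j hj h =>
    hα1 j hj (by linear_combination -h)
  have hα2' : ∀ j, ¬ (2 * N + 1) ∣ j → 1 - ζ ^ j / α ≠ 0 := fun j hj h => by
    field_simp at h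
    exact hα2 j hj (by linear_combination -h)
  have s1 : ∀ j, SpecializesTo φ (1 - a * q ^ j) (1 - α * ζ ^ j) := fun j =>
    (SpecializesTo.one φ).sub (ha.mul (hq.pow j))
  have s2 : ∀ j, SpecializesTo φ (1 - q ^ j / a) (1 - ζ ^ j / α) := fun j =>
    (SpecializesTo.one φ).sub ((hq.pow j).div ha hα)
  have s3 : ∀ j, SpecializesTo φ (1 - q ^ j) (1 - ζ ^ j) := fun j =>
    (SpecializesTo.one φ).sub (hq.pow j)
  have s4 : ∀ j, SpecializesTo φ (q ^ j)⁻¹ (ζ ^ j)⁻¹ := fun j =>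
    (hq.pow j).inv (pow_ne_zero j hζ0)
  -- Because the order is odd, `1 - ζ^(2j)` vanishes only where `1 - ζ^j` does.
  have hcop : Nat.Coprime (2 * N + 1) 2 := Nat.coprime_two_right.2 ⟨N, rfl⟩
  have hqd : 1 - q ^ (2 * N + 1) ≠ 0 := fun h => hq1 (2 * N + 1) (by omega)
    (by linear_combination -h)
  have hndvd : ∀ t r, 0 < r → r < 2 * N + 1 → ¬ (2 * N + 1) ∣ (2 * N + 1) * t + r := by
    intro t r h0 hr h
    rw [Nat.dvd_add_right (dvd_mul_right _ _)] at h
    exact absurd (Nat.le_of_dvd h0 h) (by omega)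
  have hndvd2 : ∀ t r, 0 < r → r < 2 * N + 1 → ¬ (2 * N + 1) ∣ 2 * ((2 * N + 1) * t + r) :=
    fun t r h0 hr h => hndvd t r h0 hr (hcop.dvd_of_dvd_mul_left h)
  -- The vanishing element takes one `z` from each of the two factors containing `a`, and `1 -
  -- q^(2N+1)` from the third.
  obtain ⟨β, hβ⟩ := exists_block_specialization (φ := φ) (b := baseTerm a q) (g := baseTerm α ζ)
    (z := z * z * (1 - q ^ (2 * N + 1))) hN (mul_ne_zero (mul_ne_zero hz hz) hqd)
    (by simpa [hζ1] using (hzω.mul hzω).mul (s3 (2 * N + 1)))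
    (baseTerm_zero a q) (baseTerm_zero α ζ) (fun r hr => baseTerm_eq_zero hζ1 hr)
    (by
      intro t r hr hrN
      refine ⟨_, _, ?_, baseTerm_succ hζ0 r, baseTerm_succ hq0 _⟩
      have per : ∀ i j, ζ ^ ((2 * N + 1) * i + j) = ζ ^ j := fun i j => by
        rw [pow_add, pow_mul, hζ1, one_pow, one_mul]
      have e1 : ζ ^ (2 * ((2 * N + 1) * t + r) + 1) = ζ ^ (2 * r + 1) := by
        rw [← per (2 * t) (2 * r + 1)]; congr 1; ring
      have e2 : ζ ^ ((2 * N + 1) * t + r + 1) = ζ ^ (r + 1) := by rw [add_assoc, per]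
      have e3 : ζ ^ (2 * ((2 * N + 1) * t + r) + 2) = ζ ^ (2 * r + 2) := by
        rw [← per (2 * t) (2 * r + 2)]; congr 1; ring
      have n1 := hndvd t (r + 1) (by omega) (by omega)
      have n2 := hndvd2 t (r + 1) (by omega) (by omega)
      rw [← add_assoc] at n1
      rw [← add_assoc, mul_add 2 (_ + _) 1, mul_one] at n2
      rw [← e1, ← e2, ← e3]
      exact ((((s1 _).mul (s2 _)).mul (s3 _)).mul (s4 _)).div (((s1 _).mul (s2 _)).mul (s3 _))
        (mul_ne_zero (mul_ne_zero (hα1' _ n1) (hα2' _ n1)) (hζj _ n2)))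
    (by
      intro t
      have e : 2 * ((2 * N + 1) * t + N) + 1 = (2 * N + 1) * (2 * t + 1) := by ring
      obtain ⟨w1, v1, hw1, -, e1⟩ := hz1 (2 * ((2 * N + 1) * t + N) + 1) (by omega)
        (by rw [e]; exact dvd_mul_right _ _)
      obtain ⟨w2, v2, hw2, -, e2⟩ := hz2 (2 * ((2 * N + 1) * t + N) + 1) (by omega)
        (by rw [e]; exact dvd_mul_right _ _)
      obtain ⟨w3, v3, hw3, -, e3⟩ := exists_one_sub_pow_eq (j := 2 * ((2 * N + 1) * t + N) + 1)
        hq hζ1 (by omega) (by rw [e]; exact dvd_mul_right _ _)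
      have n1 := hndvd t (N + 1) (by omega) (by omega)
      have n2 := hndvd2 t (N + 1) (by omega) (by omega)
      rw [← add_assoc] at n1
      rw [← add_assoc, mul_add 2 (_ + _) 1, mul_one] at n2
      refine ⟨_, _, (((hw1.mul hw2).mul hw3).mul (s4 ((2 * N + 1) * t + N + 1))).div
        (((s1 ((2 * N + 1) * t + N + 1)).mul (s2 ((2 * N + 1) * t + N + 1))).mul
          (s3 (2 * ((2 * N + 1) * t + N) + 2)))
        (mul_ne_zero (mul_ne_zero (hα1' _ n1) (hα2' _ n1)) (hζj _ n2)), ?_⟩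
      rw [baseTerm_succ hq0, e1, e2, e3]
      ring)
    (by
      intro t
      have e : (2 * N + 1) * t + 2 * N + 1 = (2 * N + 1) * (t + 1) := by ring
      have e' : 2 * ((2 * N + 1) * t + 2 * N) + 2 = (2 * N + 1) * (2 * t + 2) := by ring
      obtain ⟨w1, v1, hw1, hv1, e1⟩ := hz1 ((2 * N + 1) * t + 2 * N + 1) (by omega)
        (by rw [e]; exact dvd_mul_right _ _)
      obtain ⟨w2, v2, hw2, hv2, e2⟩ := hz2 ((2 * N + 1) * t + 2 * N + 1) (by omega)
        (by rw [e]; exact dvd_mul_right _ _)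
      obtain ⟨w3, v3, hw3, hv3, e3⟩ := exists_one_sub_pow_eq
        (j := 2 * ((2 * N + 1) * t + 2 * N) + 2) hq hζ1 (by omega)
        (by rw [e']; exact dvd_mul_right _ _)
      refine ⟨_, _, ((((s1 (2 * ((2 * N + 1) * t + 2 * N) + 1)).mul
        (s2 (2 * ((2 * N + 1) * t + 2 * N) + 1))).mul
          (s3 (2 * ((2 * N + 1) * t + 2 * N) + 1))).mul (s4 ((2 * N + 1) * t + 2 * N + 1))).div
        ((hw1.mul hw2).mul hw3) (mul_ne_zero (mul_ne_zero hv1 hv2) hv3), ?_⟩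
      rw [baseTerm_succ hq0, e1, e2, e3, mul_assoc]
      congr 1
      rw [show z * w1 * (z * w2) * ((1 - q ^ (2 * N + 1)) * w3) =
        w1 * w2 * w3 * (z * z * (1 - q ^ (2 * N + 1))) by ring, div_mul_eq_mul_div,
        mul_div_mul_right _ _ (mul_ne_zero (mul_ne_zero hz hz) hqd)])
  have hqInt : ∀ t r, qInt ζ (3 * ((2 * N + 1) * t + r) + 1) = qInt ζ (3 * r + 1) := by
    intro t r
    have h1 : 1 - ζ ≠ 0 := by
      simpa using hζj 1 fun h => absurd (Nat.le_of_dvd one_pos h) (by omega)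
    apply mul_left_cancel₀ h1
    rw [one_sub_mul_qInt, one_sub_mul_qInt,
      show 3 * ((2 * N + 1) * t + r) + 1 = (2 * N + 1) * (3 * t) + (3 * r + 1) by ring, pow_add,
      pow_mul, hζ1, one_pow, one_mul]
  have hc : ∀ k, SpecializesTo φ (cTermParam a q k)
      (β (k / (2 * N + 1)) * cTermParam α ζ (k % (2 * N + 1))) := by
    intro k
    have h := (hq.qInt (3 * k + 1)).mul (hβ (k / (2 * N + 1)) _ (Nat.mod_lt k (by omega)))
    have hI := hqInt (k / (2 * N + 1)) (k % (2 * N + 1))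
    rw [Nat.div_add_mod] at h hI
    rw [cTermParam_eq, cTermParam_eq, ← hI, mul_left_comm]
    exact h
  have := SpecializesTo.truncSquare (n := (2 * N + 1) * m) fun k _ => hc k
  rwa [truncSquare_eq_zero (β := β) (γ := cTermParam α ζ)] at this
  · intro t r hr
    rw [Nat.mul_add_div (by omega), Nat.div_eq_of_lt hr, add_zero, Nat.mul_add_mod,
      Nat.mod_eq_of_lt hr]
  · intro r hr _
    rw [cTermParam_eq, baseTerm_eq_zero hζ1 hr, mul_zero]
  · exact sum_cTermParam_rootOfUnity hN hζ hα hα1 hα2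

end RootOfUnity

/-! ### Reduced fractions and congruences. -/

section ReducedFractions

set_option linter.unusedSectionVars false

variable {A K : Type*} [CommRing A] [IsDomain A] [UniqueFactorizationMonoid A] [Field K]
  [Algebra A K] [IsFractionRing A K]

lemma exists_isRelPrime_fraction (f : K) :
    ∃ U V : A, V ≠ 0 ∧ IsRelPrime U V ∧ f = algebraMap A K U / algebraMap A K V := by
  obtain ⟨U, V, h, rfl⟩ := IsFractionRing.exists_reduced_fraction A f
  exact ⟨U, V, nonZeroDivisors.ne_zero V.2, h, IsFractionRing.mk'_eq_div V⟩

/-- In a reduced fraction any divisor of the numerator is prime to the denominator. -/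
lemma ratCongr_of_isRelPrime_fraction {P U V : A} {f g : K} (hV : V ≠ 0) (hUV : IsRelPrime U V)
    (h : f - g = algebraMap A K U / algebraMap A K V) (hP : P ∣ U) : RatCongr P f g := by
  obtain ⟨N, rfl⟩ := hP
  exact ⟨N, V, hV, (hUV.of_mul_left_left).symm, h⟩

/-- The denominator of a reduced fraction is not killed by a specialization. -/
lemma SpecializesTo.map_den_ne_zero {L : Type*} [Field L] {φ : A →+* L} {f : K} {v : L}
    (hf : SpecializesTo φ f v) {U V : A} (hV : V ≠ 0) (hUV : IsRelPrime U V)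
    (h : f = algebraMap A K U / algebraMap A K V) : φ V ≠ 0 := by
  obtain ⟨N, D, hD, h', -⟩ := hf
  have hV' : algebraMap A K V ≠ 0 := by rwa [Ne, IsFractionRing.to_map_eq_zero_iff]
  rw [h, div_eq_div_iff hV' (SpecializesTo.algebraMap_ne_zero hD), ← map_mul, ← map_mul] at h'
  have hVD : V ∣ D := hUV.symm.dvd_of_dvd_mul_left
    (Dvd.intro_left _ (IsFractionRing.injective A K h').symm)
  obtain ⟨E, rfl⟩ := hVD
  intro h0
  exact hD (by rw [map_mul, h0, zero_mul])

end ReducedFractions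

/-! ### Divisibility by cyclotomic products, tested at roots of unity. -/

section Cyclotomic

/-- A primitive complex `d`-th root of unity. -/
noncomputable def zetaC (d : ℕ) : ℂ := Complex.exp (2 * Real.pi * Complex.I / d)

lemma isPrimitiveRoot_zetaC {d : ℕ} (hd : d ≠ 0) : IsPrimitiveRoot (zetaC d) d :=
  Complex.isPrimitiveRoot_exp d hd

lemma cyclotomic_dvd_iff {d : ℕ} (hd : 0 < d) {p : ℚ[X]} :
    cyclotomic d ℚ ∣ p ↔ aeval (zetaC d) p = 0 := by
  rw [cyclotomic_eq_minpoly_rat (isPrimitiveRoot_zetaC hd.ne') hd]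
  exact minpoly.dvd_iff

lemma qInt_X_eq_prod {n : ℕ} (hn : 0 < n) :
    qInt (X : ℚ[X]) n = ∏ d ∈ n.divisors.erase 1, cyclotomic d ℚ :=
  (prod_cyclotomic_eq_geom_sum hn ℚ).symm

lemma qInt_dvd_of_aeval_eq_zero {n : ℕ} (hn : 0 < n) {p : ℚ[X]}
    (h : ∀ d, d ∣ n → 1 < d → aeval (zetaC d) p = 0) : qInt (X : ℚ[X]) n ∣ p := by
  rw [qInt_X_eq_prod hn]
  refine Finset.prod_dvd_of_coprime (fun i _ j _ hij => cyclotomic.isCoprime_rat hij) fun d hd => ?_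
  rw [Finset.mem_erase, Nat.mem_divisors] at hd
  have hd0 := Nat.pos_of_dvd_of_pos hd.2.1 hn
  exact (cyclotomic_dvd_iff hd0).2 (h d hd.2.1 (by omega))

/-- `[n]` contains `Φ_n` once, so the modulus is `Φ_n³` times the remaining `Φ_d`, all pairwise
coprime. -/
lemma qInt_mul_cyclotomic_sq_dvd {n : ℕ} (hn : 1 < n) {p : ℚ[X]}
    (h : ∀ d, d ∣ n → 1 < d → aeval (zetaC d) p = 0) (h' : cyclotomic n ℚ ^ 3 ∣ p) :
    qInt (X : ℚ[X]) n * cyclotomic n ℚ ^ 2 ∣ p := by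
  have hmem : n ∈ n.divisors.erase 1 := by simp; omega
  rw [qInt_X_eq_prod (by omega), ← Finset.mul_prod_erase _ _ hmem, mul_right_comm, ← pow_succ']
  refine IsCoprime.mul_dvd (IsCoprime.pow_left (IsCoprime.prod_right fun d hd => ?_)) h'
    (Finset.prod_dvd_of_coprime (fun i _ j _ hij => cyclotomic.isCoprime_rat hij) fun d hd => ?_)
  · exact cyclotomic.isCoprime_rat (Finset.ne_of_mem_erase hd).symm
  · rw [Finset.mem_erase, Finset.mem_erase, Nat.mem_divisors] at hd
    have hd0 := Nat.pos_of_dvd_of_pos hd.2.2.1 (by omega : 0 < n)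
    exact (cyclotomic_dvd_iff hd0).2 (h d hd.2.2.1 (by omega))

end Cyclotomic

/-! ### Transcendence of the variables. -/

section RatFuncFacts

lemma ratFunc_X_pow_ne_one {k : Type*} [Field k] {i : ℕ} (hi : 0 < i) :
    (RatFunc.X : RatFunc k) ^ i ≠ 1 := by
  intro h
  rw [← RatFunc.algebraMap_X, ← map_pow, ← map_one (algebraMap k[X] (RatFunc k))] at h
  have := congrArg natDegree (RatFunc.algebraMap_injective k h)
  rw [natDegree_X_pow, natDegree_one] at this
  omega

lemma ratFunc_X_mul_C_ne_one {k : Type*} [Field k] (c : k) :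
    (RatFunc.X : RatFunc k) * RatFunc.C c ≠ 1 := by
  intro h
  rw [← RatFunc.algebraMap_X, ← RatFunc.algebraMap_C, ← map_mul,
    ← map_one (algebraMap k[X] (RatFunc k))] at h
  have := congrArg (eval 0) (RatFunc.algebraMap_injective k h)
  simp at this

lemma ratFunc_C_ne_X {k : Type*} [Field k] (c : k) : (RatFunc.C c : RatFunc k) ≠ RatFunc.X := by
  intro h
  rw [← RatFunc.algebraMap_X, ← RatFunc.algebraMap_C] at h
  exact X_ne_C c (RatFunc.algebraMap_injective k h).symm

lemma ratFunc_C_X_pow_ne_one {i : ℕ} (hi : 0 < i) :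
    (RatFunc.C (X : ℚ[X]) : RatFunc ℚ[X]) ^ i ≠ 1 := by
  intro h
  rw [← RatFunc.algebraMap_C, ← map_pow, ← map_one (algebraMap ℚ[X][X] (RatFunc ℚ[X]))] at h
  have := RatFunc.algebraMap_injective ℚ[X] h
  rw [← C_pow, ← C_1, C_inj] at this
  have := congrArg natDegree this
  rw [natDegree_X_pow, natDegree_one] at this
  omega

end RatFuncFacts

/-! ### Vanishing at roots of unity for `a = 1`. -/

section OneVariable

lemma specializesTo_X_aeval (z : ℂ) :
    SpecializesTo (aeval z : ℚ[X] →ₐ[ℚ] ℂ).toRingHom (RatFunc.X : RatFunc ℚ) z := by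
  simpa using SpecializesTo.of_algebraMap (K := RatFunc ℚ) (aeval z : ℚ[X] →ₐ[ℚ] ℂ).toRingHom X

lemma qInt_eq_zero {L : Type*} [Field L] {z : L} {d n : ℕ} (hz : IsPrimitiveRoot z d) (hd : 1 < d)
    (hdn : d ∣ n) : qInt z n = 0 := by
  have h1 : 1 - z ≠ 0 := sub_ne_zero.2 (hz.ne_one hd).symm
  apply mul_left_cancel₀ h1
  rw [one_sub_mul_qInt, (hz.pow_eq_one_iff_dvd n).2 hdn, sub_self, mul_zero]

lemma specializesTo_truncSquare_cTerm {n d : ℕ} (hn : Odd n) (hdn : d ∣ n) (hd : 1 < d) :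
    SpecializesTo (aeval (zetaC d) : ℚ[X] →ₐ[ℚ] ℂ).toRingHom
      (truncSquare (cTerm (RatFunc.X : RatFunc ℚ)) n) 0 := by
  obtain ⟨m, rfl⟩ := hdn
  obtain ⟨N, rfl⟩ := (Nat.odd_mul.1 hn).1
  have hζ := isPrimitiveRoot_zetaC (d := 2 * N + 1) (by omega)
  have hq := specializesTo_X_aeval (zetaC (2 * N + 1))
  have hq1 : ∀ i, 0 < i → (RatFunc.X : RatFunc ℚ) ^ i ≠ 1 := fun i hi => ratFunc_X_pow_ne_one hi
  rw [← cTermParam_one]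
  refine specializesTo_truncSquare_zero (z := 1 - RatFunc.X ^ (2 * N + 1)) (by omega) hζ
    (SpecializesTo.one _) hq one_ne_zero ?_ ?_ hq1 (sub_ne_zero.2 (hq1 _ (by omega)).symm)
    ((SpecializesTo.one _).sub (hq.pow _)) ?_ ?_
  · intro j hj h
    exact hj ((hζ.pow_eq_one_iff_dvd j).1 (by rwa [one_mul] at h))
  · intro j hj h
    exact hj ((hζ.pow_eq_one_iff_dvd j).1 h)
  · intro j hj hdj
    simpa using exists_one_sub_pow_eq hq hζ.pow_eq_one hj hdj
  · intro j hj hdj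
    simpa using exists_one_sub_pow_eq hq hζ.pow_eq_one hj hdj

end OneVariable

/-! ### The parametric congruence. -/

section TwoVariables

/-- The difference of the two sides of the parametric congruence. -/
noncomputable def paramDiff (n : ℕ) : RatFunc ℚ[X] :=
  truncSquare (cTermParam (RatFunc.X : RatFunc ℚ[X]) (RatFunc.C (X : ℚ[X]))) n -
    RatFunc.C (X : ℚ[X]) ^ (1 - (n : ℤ)) * qInt (RatFunc.C (X : ℚ[X])) n ^ 2

lemma specializesTo_X {L : Type*} [Field L] (φ : ℚ[X][X] →+* L) :
    SpecializesTo φ (RatFunc.X : RatFunc ℚ[X]) (φ X) := by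
  simpa using SpecializesTo.of_algebraMap (K := RatFunc ℚ[X]) φ X

lemma specializesTo_C_X {L : Type*} [Field L] (φ : ℚ[X][X] →+* L) :
    SpecializesTo φ (RatFunc.C X : RatFunc ℚ[X]) (φ (C X)) := by
  simpa using SpecializesTo.of_algebraMap (K := RatFunc ℚ[X]) φ (C X)

lemma specializesTo_paramDiff {L : Type*} [Field L] (φ : ℚ[X][X] →+* L) {a q : L} {n : ℕ}
    (ha : φ X = a) (hq : φ (C X) = q) (ha0 : a ≠ 0) (hq0 : q ≠ 0)
    (h1 : ∀ i, 0 < i → i < n → a * q ^ i ≠ 1) (h2 : ∀ i, 0 < i → i < n → q ^ i ≠ a)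
    (h3 : ∀ i, 0 < i → i < n → q ^ (2 * i) ≠ 1) :
    SpecializesTo φ (paramDiff n)
      (truncSquare (cTermParam a q) n - q ^ (1 - (n : ℤ)) * qInt q n ^ 2) := by
  have sa := specializesTo_X φ
  have sq := specializesTo_C_X φ
  rw [ha] at sa
  rw [hq] at sq
  refine (SpecializesTo.truncSquare fun k hk => sa.cTermParam sq ha0 hq0 ?_ ?_ ?_).sub
    ((sq.zpow hq0 _).mul ((sq.qInt n).pow 2))
  · exact fun i hi => h1 _ (by omega) (by omega)
  · exact fun i hi => h2 _ (by omega) (by omega)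
  · exact fun i hi => h3 _ (by omega) (by omega)

/-- Evaluation of `q` at a complex number, keeping `a` generic. -/
noncomputable def evalQ (z : ℂ) : ℚ[X][X] →+* RatFunc ℂ :=
  (algebraMap ℂ[X] (RatFunc ℂ)).comp (mapRingHom (aeval z : ℚ[X] →ₐ[ℚ] ℂ).toRingHom)

lemma specializesTo_paramDiff_evalQ {n d : ℕ} (hn : Odd n) (hdn : d ∣ n) (hd : 1 < d) :
    SpecializesTo (evalQ (zetaC d)) (paramDiff n) 0 := by
  obtain ⟨m, rfl⟩ := hdn
  obtain ⟨N, rfl⟩ := (Nat.odd_mul.1 hn).1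
  have hζ : IsPrimitiveRoot (RatFunc.C (zetaC (2 * N + 1)) : RatFunc ℂ) (2 * N + 1) :=
    (isPrimitiveRoot_zetaC (by omega)).map_of_injective RatFunc.C_injective
  have ha := specializesTo_X (evalQ (zetaC (2 * N + 1)))
  have hq := specializesTo_C_X (evalQ (zetaC (2 * N + 1)))
  rw [show evalQ (zetaC (2 * N + 1)) X = RatFunc.X by simp [evalQ]] at ha
  rw [show evalQ (zetaC (2 * N + 1)) (C X) = RatFunc.C (zetaC (2 * N + 1)) by simp [evalQ]] at hq
  have n1 : ∀ j, (RatFunc.X : RatFunc ℂ) * RatFunc.C (zetaC (2 * N + 1)) ^ j ≠ 1 := fun j => by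
    rw [← map_pow]; exact ratFunc_X_mul_C_ne_one _
  have n2 : ∀ j, (RatFunc.C (zetaC (2 * N + 1)) : RatFunc ℂ) ^ j ≠ RatFunc.X := fun j => by
    rw [← map_pow]; exact ratFunc_C_ne_X _
  have hX : (RatFunc.X : RatFunc ℂ) ≠ 0 := RatFunc.X_ne_zero
  -- `a` stays transcendental, so no factor containing it vanishes and `z = 1` serves.
  have h1 := specializesTo_truncSquare_zero (z := (1 : RatFunc ℚ[X])) (m := m) (by omega) hζ ha hq
    hX (fun j _ => n1 j) (fun j _ => n2 j) (fun i hi => ratFunc_C_X_pow_ne_one hi)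
    one_ne_zero (SpecializesTo.one _)
    (fun j _ _ => ⟨_, _, (SpecializesTo.one _).sub (ha.mul (hq.pow j)),
      sub_ne_zero.2 (n1 j).symm, (one_mul _).symm⟩)
    (fun j _ _ => ⟨_, _, (SpecializesTo.one _).sub ((hq.pow j).div ha hX),
      sub_ne_zero.2 fun h => n2 j ((div_eq_one_iff_eq hX).1 h.symm), (one_mul _).symm⟩)
  have h2 := (hq.zpow (hζ.ne_zero (by omega)) (1 - (((2 * N + 1) * m : ℕ) : ℤ))).mul
    ((hq.qInt ((2 * N + 1) * m)).pow 2)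
  rw [qInt_eq_zero hζ hd (dvd_mul_right _ _)] at h2
  simpa [paramDiff] using h1.sub h2

/-- Evaluation of `a` at an element of `ℚ(q)`. -/
noncomputable def evalA (y : RatFunc ℚ) : ℚ[X][X] →+* RatFunc ℚ :=
  eval₂RingHom (algebraMap ℚ[X] (RatFunc ℚ)) y

lemma evalA_X (y : RatFunc ℚ) : evalA y X = y := by simp [evalA]

lemma evalA_C_X (y : RatFunc ℚ) : evalA y (C X) = RatFunc.X := by simp [evalA]

/-- For `k > N` the product `(q/a; q²)_k` contains `1 - q^(-2N) q^(2N) = 0`, so the truncated square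
is a full square. -/
lemma truncSquare_cTermParam_pow {K : Type*} [Field K] {q : K} (hq : q ≠ 0)
    (hq1 : ∀ i, 0 < i → q ^ i ≠ 1) {n : ℕ} (hn : Odd n) :
    truncSquare (cTermParam (q ^ n) q) n - q ^ (1 - (n : ℤ)) * qInt q n ^ 2 = 0 := by
  obtain ⟨N, rfl⟩ := hn
  rw [truncSquare_eq_sq, sum_cTermParam_pow hq hq1,
    show (1 - ((2 * N + 1 : ℕ) : ℤ)) = -((2 * N : ℕ) : ℤ) by push_cast; ring, zpow_neg,
    zpow_natCast]
  · field_simp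
    ring
  · intro k hk _
    have : qPoch (q / q ^ (2 * N + 1)) (q ^ 2) k = 0 :=
      qPoch_eq_zero N hk (by rw [← pow_mul, pow_succ]; field_simp)
    simp [cTermParam, this]

lemma specializesTo_paramDiff_pow {n : ℕ} (hn : Odd n) :
    SpecializesTo (evalA (RatFunc.X ^ n)) (paramDiff n) 0 := by
  have hX : (RatFunc.X : RatFunc ℚ) ≠ 0 := RatFunc.X_ne_zero
  rw [← truncSquare_cTermParam_pow hX (fun i hi => ratFunc_X_pow_ne_one hi) hn]
  refine specializesTo_paramDiff _ (evalA_X _) (evalA_C_X _) (pow_ne_zero _ hX) hX ?_ ?_ ?_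
  · intro i hi _
    rw [← pow_add]
    exact ratFunc_X_pow_ne_one (by omega)
  · intro i _ hi h
    refine ratFunc_X_pow_ne_one (k := ℚ) (i := n - i) (by omega) ?_
    apply mul_right_cancel₀ (pow_ne_zero i hX)
    rw [← pow_add, Nat.sub_add_cancel hi.le, one_mul, h]
  · exact fun i hi _ => ratFunc_X_pow_ne_one (by omega)

lemma specializesTo_paramDiff_inv_pow {n : ℕ} (hn : Odd n) :
    SpecializesTo (evalA (RatFunc.X ^ n)⁻¹) (paramDiff n) 0 := by
  have hX : (RatFunc.X : RatFunc ℚ) ≠ 0 := RatFunc.X_ne_zero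
  rw [← truncSquare_cTermParam_pow hX (fun i hi => ratFunc_X_pow_ne_one hi) hn,
    show cTermParam ((RatFunc.X : RatFunc ℚ) ^ n) RatFunc.X =
      cTermParam (RatFunc.X ^ n)⁻¹ RatFunc.X from (funext fun k => cTermParam_inv _ _ k).symm]
  refine specializesTo_paramDiff _ (evalA_X _) (evalA_C_X _) (inv_ne_zero (pow_ne_zero _ hX)) hX
    ?_ ?_ ?_
  · intro i _ hi h
    refine ratFunc_X_pow_ne_one (k := ℚ) (i := n - i) (by omega) ?_
    apply mul_right_cancel₀ (pow_ne_zero i hX)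
    rw [← pow_add, Nat.sub_add_cancel hi.le, one_mul]
    rw [inv_mul_eq_one₀ (pow_ne_zero _ hX)] at h
    exact h
  · intro i hi _ h
    refine ratFunc_X_pow_ne_one (k := ℚ) (i := i + n) (by omega) ?_
    rw [pow_add, h, inv_mul_cancel₀ (pow_ne_zero _ hX)]
  · exact fun i hi _ => ratFunc_X_pow_ne_one (by omega)

lemma X_sub_dvd_of_evalA {n : ℕ} {U : ℚ[X][X]} (h : evalA (RatFunc.X ^ n) U = 0) :
    X - C X ^ n ∣ U := by
  rw [← C_pow, dvd_iff_isRoot]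
  apply RatFunc.algebraMap_injective ℚ
  rw [map_zero, ← h, evalA, coe_eval₂RingHom, ← RatFunc.algebraMap_X, ← map_pow, eval₂_at_apply]

lemma isPrimitive_one_sub_X_mul (p : ℚ[X]) : (1 - X * C p : ℚ[X][X]).IsPrimitive := by
  intro r hr
  rw [C_dvd_iff_dvd_coeff] at hr
  have := hr 0
  simp only [coeff_sub, coeff_one_zero, mul_coeff_zero, coeff_X_zero, zero_mul, sub_zero] at this
  exact isUnit_of_dvd_one this

/-- Over `ℚ(q)` this is the factor theorem at `a = q^(-n)`. Gauss's lemma brings it down to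
`ℚ[q][a]`, since `1 - a q^n` has constant term `1` and is therefore primitive. -/
lemma one_sub_X_mul_dvd_of_evalA {n : ℕ} {U : ℚ[X][X]} (h : evalA (RatFunc.X ^ n)⁻¹ U = 0) :
    1 - X * C X ^ n ∣ U := by
  have hX : (RatFunc.X : RatFunc ℚ) ^ n ≠ 0 := pow_ne_zero _ RatFunc.X_ne_zero
  rw [← C_pow]
  apply (isPrimitive_one_sub_X_mul _).dvd_of_fraction_map_dvd_fraction_map (K := RatFunc ℚ)
  have hroot : X - C (RatFunc.X ^ n)⁻¹ ∣ map (algebraMap ℚ[X] (RatFunc ℚ)) U := by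
    rw [dvd_iff_isRoot, IsRoot, eval_map]
    exact h
  have : map (algebraMap ℚ[X] (RatFunc ℚ)) (1 - X * C (X ^ n)) =
      C (-RatFunc.X ^ n) * (X - C (RatFunc.X ^ n)⁻¹) := by
    rw [Polynomial.map_sub, Polynomial.map_one, Polynomial.map_mul, map_X, Polynomial.map_C,
      map_pow, RatFunc.algebraMap_X, mul_sub, ← C_mul, neg_mul, mul_inv_cancel₀ hX]
    simp only [C_neg, C_1]
    ring
  rw [this]
  exact (IsUnit.mul_left_dvd (isUnit_C.2 (neg_ne_zero.2 hX).isUnit)).2 hroot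

lemma C_qInt (n : ℕ) : qInt (C X : ℚ[X][X]) n = C (qInt (X : ℚ[X]) n) := by
  simp [qInt]

/-- Evaluating `q` while `a` stays free tests all coefficients in `a` at once. -/
lemma qInt_dvd_of_evalQ {n : ℕ} (hn : 0 < n) {U : ℚ[X][X]}
    (h : ∀ d, d ∣ n → 1 < d → evalQ (zetaC d) U = 0) : qInt (C X : ℚ[X][X]) n ∣ U := by
  rw [C_qInt, C_dvd_iff_dvd_coeff]
  refine fun i => qInt_dvd_of_aeval_eq_zero hn fun d hdn hd => ?_
  have h0 := h d hdn hd
  rw [evalQ, RingHom.comp_apply, map_eq_zero_iff _ (RatFunc.algebraMap_injective ℂ)] at h0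
  simpa using congrArg (fun p => coeff p i) h0

lemma qInt_X_ne_zero {n : ℕ} (hn : 0 < n) : qInt (X : ℚ[X]) n ≠ 0 := by
  rw [qInt_X_eq_prod hn]
  exact Finset.prod_ne_zero_iff.2 fun d _ => cyclotomic_ne_zero d ℚ

lemma param_modulus_dvd {n : ℕ} (hn : 0 < n) {U : ℚ[X][X]} (h1 : qInt (C X : ℚ[X][X]) n ∣ U)
    (h2 : 1 - X * C X ^ n ∣ U) (h3 : X - C X ^ n ∣ U) :
    qInt (C X : ℚ[X][X]) n * (1 - X * C X ^ n) * (X - C X ^ n) ∣ U := by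
  have hp : Prime (X - C X ^ n : ℚ[X][X]) := by
    rw [← C_pow]; exact prime_X_sub_C _
  refine IsRelPrime.mul_dvd ?_ (IsRelPrime.mul_dvd ?_ h1 h2) h3
  · refine ((hp.irreducible.isRelPrime_iff_not_dvd).2 ?_).symm
    rw [← C_pow, dvd_iff_isRoot, IsRoot, C_qInt]
    simp only [eval_mul, eval_C, eval_sub, eval_one, eval_X]
    refine mul_ne_zero (qInt_X_ne_zero hn) fun h => ?_
    have := congrArg (eval 0) h
    simp [hn.ne'] at this
  -- A common divisor has degree `0` in `a`, as `[n]` has, and a constant dividing a primitive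
  -- polynomial is a unit.
  · intro p hp1 hp2
    rw [C_qInt] at hp1
    have hdeg : p.natDegree = 0 := by
      have := natDegree_le_of_dvd hp1 (C_ne_zero.2 (qInt_X_ne_zero hn))
      simpa using this
    rw [eq_C_of_natDegree_eq_zero hdeg] at hp2 ⊢
    rw [← C_pow] at hp2
    exact isUnit_C.2 (isPrimitive_one_sub_X_mul _ _ hp2)

lemma exists_paramDiff_fraction {n : ℕ} (hn : Odd n) :
    ∃ U V : ℚ[X][X], V ≠ 0 ∧ IsRelPrime U V ∧
      paramDiff n = algebraMap ℚ[X][X] (RatFunc ℚ[X]) U / algebraMap ℚ[X][X] (RatFunc ℚ[X]) V ∧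
      qInt (C X : ℚ[X][X]) n * (1 - X * (C X) ^ n) * (X - (C X) ^ n) ∣ U := by
  obtain ⟨U, V, hV, hUV, h⟩ := exists_isRelPrime_fraction (A := ℚ[X][X]) (paramDiff n)
  refine ⟨U, V, hV, hUV, h, param_modulus_dvd hn.pos
    (qInt_dvd_of_evalQ hn.pos fun d hdn hd => ?_) (one_sub_X_mul_dvd_of_evalA ?_)
    (X_sub_dvd_of_evalA ?_)⟩
  · simpa using (specializesTo_paramDiff_evalQ hn hdn hd).map_num_eq hV h
  · simpa using (specializesTo_paramDiff_inv_pow hn).map_num_eq hV h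
  · simpa using (specializesTo_paramDiff_pow hn).map_num_eq hV h

end TwoVariables

/-! ### Descent to `a = 1` and conclusion. -/

section MainTheorem

lemma cyclotomic_dvd_qInt {n : ℕ} (hn : 1 < n) : cyclotomic n ℚ ∣ qInt (X : ℚ[X]) n := by
  rw [qInt_X_eq_prod (by omega)]
  exact Finset.dvd_prod_of_mem _ (by simp; omega)

lemma cyclotomic_dvd_one_sub_X_pow {n : ℕ} (hn : 1 < n) : cyclotomic n ℚ ∣ 1 - X ^ n := by
  rw [← one_sub_mul_qInt]
  exact (cyclotomic_dvd_qInt hn).mul_left _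

/-- The parametric congruence specialized to `a = 1`, in cross-multiplied form. -/
lemma exists_cTerm_fraction {n : ℕ} (hn : Odd n) (hn1 : 1 < n) :
    ∃ U V : ℚ[X], ¬ cyclotomic n ℚ ∣ V ∧ cyclotomic n ℚ ^ 3 ∣ U ∧
      (truncSquare (cTerm (RatFunc.X : RatFunc ℚ)) n - RatFunc.X ^ (1 - (n : ℤ)) *
        qInt (RatFunc.X : RatFunc ℚ) n ^ 2) * algebraMap ℚ[X] (RatFunc ℚ) V =
          algebraMap ℚ[X] (RatFunc ℚ) U := by
  obtain ⟨U, V, hV, hUV, h, hP⟩ := exists_paramDiff_fraction hn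
  have hX : (RatFunc.X : RatFunc ℚ) ≠ 0 := RatFunc.X_ne_zero
  have hζ := isPrimitiveRoot_zetaC (d := n) (by omega)
  have hζi : ∀ i, 0 < i → i < n → zetaC n ^ i ≠ 1 := fun i h0 hi h1 =>
    absurd (Nat.le_of_dvd h0 ((hζ.pow_eq_one_iff_dvd i).1 h1)) (by omega)
  have hζ2 : ∀ i, 0 < i → i < n → zetaC n ^ (2 * i) ≠ 1 := fun i h0 hi h1 =>
    absurd (Nat.le_of_dvd h0 ((Nat.coprime_two_right.2 hn).dvd_of_dvd_mul_left
      ((hζ.pow_eq_one_iff_dvd _).1 h1))) (by omega)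
  have eval_eq : ∀ W : ℚ[X][X], evalA 1 W = algebraMap ℚ[X] (RatFunc ℚ) (eval 1 W) := fun W => by
    rw [evalA, coe_eval₂RingHom, ← map_one (algebraMap ℚ[X] (RatFunc ℚ)), eval₂_at_apply]
  -- Two substitutions with `a = 1`: `s1` keeps `q` generic and gives the identity; `s2` puts `q =
  -- ζ_n` and shows that `Φ_n` does not divide the denominator.
  have s1 := specializesTo_paramDiff (n := n) (evalA 1) (evalA_X 1) (evalA_C_X 1) one_ne_zero hX
    (fun i hi _ => by rw [one_mul]; exact ratFunc_X_pow_ne_one hi)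
    (fun i hi _ => ratFunc_X_pow_ne_one hi) (fun i hi _ => ratFunc_X_pow_ne_one (by omega))
  have s2 := specializesTo_paramDiff (n := n) (a := 1) (q := zetaC n)
    ((aeval (zetaC n) : ℚ[X] →ₐ[ℚ] ℂ).toRingHom.comp (evalRingHom 1)) (by simp) (by simp)
    one_ne_zero (hζ.ne_zero (by omega)) (fun i h0 hi => by rw [one_mul]; exact hζi i h0 hi)
    hζi hζ2
  refine ⟨eval 1 U, eval 1 V, ?_, ?_, ?_⟩
  · rw [cyclotomic_dvd_iff (by omega)]
    exact s2.map_den_ne_zero hV hUV h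
  -- At `a = 1` the modulus is `[n] (1 - q^n)²`, each of whose three factors contains `Φ_n`.
  · refine dvd_trans ?_ (eval_dvd (x := 1) hP)
    rw [C_qInt]
    simp only [eval_mul, eval_sub, eval_one, eval_X, eval_pow, eval_C, one_mul, pow_succ, pow_zero]
    exact mul_dvd_mul (mul_dvd_mul (cyclotomic_dvd_qInt hn1) (cyclotomic_dvd_one_sub_X_pow hn1))
      (cyclotomic_dvd_one_sub_X_pow hn1)
  · rw [← eval_eq, ← eval_eq, s1.map_num_eq hV h, cTermParam_one]

/-- Replacing `q^(1-n) [n]²` by `q [n]²` costs `q^(1-n) (1 - q^n) [n]²`, again a multiple of `Φ_n³`.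
-/
lemma cyclotomic_cube_dvd {n : ℕ} (hn : Odd n) (hn1 : 1 < n) {U V : ℚ[X]} (hV : V ≠ 0)
    (h : truncSquare (cTerm (RatFunc.X : RatFunc ℚ)) n -
      RatFunc.X * qInt (RatFunc.X : RatFunc ℚ) n ^ 2 =
        algebraMap ℚ[X] (RatFunc ℚ) U / algebraMap ℚ[X] (RatFunc ℚ) V) :
    cyclotomic n ℚ ^ 3 ∣ U := by
  obtain ⟨U', V', hV', hU', h'⟩ := exists_cTerm_fraction hn hn1
  have hX : (RatFunc.X : RatFunc ℚ) ≠ 0 := RatFunc.X_ne_zero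
  have hp : Prime (cyclotomic n ℚ) := (cyclotomic.irreducible_rat (by omega)).prime
  have hpX : ¬ cyclotomic n ℚ ∣ X ^ (n - 1) := by
    rw [cyclotomic_dvd_iff (by omega)]
    simpa using fun h0 => absurd h0 ((isPrimitiveRoot_zetaC (d := n) (by omega)).ne_zero (by omega))
  refine hp.pow_dvd_of_dvd_mul_right (b := X ^ (n - 1) * V') 3
    (fun hd => (hp.dvd_or_dvd hd).elim hpX hV') ?_
  have e : U * (X ^ (n - 1) * V') =
      V * (X ^ (n - 1) * U' + (1 - X ^ n) * qInt (X : ℚ[X]) n * qInt (X : ℚ[X]) n * V') := by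
    apply RatFunc.algebraMap_injective ℚ
    have hVK : algebraMap ℚ[X] (RatFunc ℚ) V ≠ 0 := by
      rwa [Ne, IsFractionRing.to_map_eq_zero_iff]
    have hI : algebraMap ℚ[X] (RatFunc ℚ) (qInt X n) = qInt RatFunc.X n := by
      simp [qInt]
    rw [eq_div_iff hVK] at h
    simp only [map_mul, map_add, map_sub, map_one, map_pow, RatFunc.algebraMap_X, hI]
    rw [← h, ← h', show (1 - (n : ℤ)) = -((n - 1 : ℕ) : ℤ) by
      rw [Nat.cast_sub hn1.le]; push_cast; ring, zpow_neg, zpow_natCast,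
      show (RatFunc.X : RatFunc ℚ) ^ n = RatFunc.X ^ (n - 1) * RatFunc.X by
        rw [← pow_succ, Nat.sub_add_cancel hn1.le]]
    field_simp
    ring
  rw [e]
  refine Dvd.dvd.mul_left (dvd_add (hU'.mul_left _) (Dvd.dvd.mul_right ?_ _)) _
  rw [pow_succ, pow_two]
  exact mul_dvd_mul (mul_dvd_mul (cyclotomic_dvd_one_sub_X_pow hn1) (cyclotomic_dvd_qInt hn1))
    (cyclotomic_dvd_qInt hn1)

end MainTheorem

/-- In the first part `q` is the variable of `ℚ(q)`. In the second part the polynomial ring is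
`ℚ[q][a]`: `a` is the outer variable `X` and `q` is the constant `C X`. -/
theorem theorem1 (n : ℕ) (hn : Odd n) :
    (1 < n →
      RatCongr (qInt (X : ℚ[X]) n * cyclotomic n ℚ ^ 2)
        (truncSquare (cTerm (RatFunc.X : RatFunc ℚ)) n)
        (RatFunc.X * qInt (RatFunc.X : RatFunc ℚ) n ^ 2)) ∧
      RatCongr
        (qInt (C X : ℚ[X][X]) n * (1 - X * (C X) ^ n) * (X - (C X) ^ n))
        (truncSquare (cTermParam (RatFunc.X : RatFunc ℚ[X]) (RatFunc.C (X : ℚ[X]))) n)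
        (RatFunc.C (X : ℚ[X]) ^ (1 - (n : ℤ)) * qInt (RatFunc.C (X : ℚ[X])) n ^ 2) := by
  refine ⟨fun hn1 => ?_, ?_⟩
  · obtain ⟨U, V, hV, hUV, h⟩ := exists_isRelPrime_fraction (A := ℚ[X])
      (truncSquare (cTerm (RatFunc.X : RatFunc ℚ)) n -
        RatFunc.X * qInt (RatFunc.X : RatFunc ℚ) n ^ 2)
    refine ratCongr_of_isRelPrime_fraction hV hUV h (qInt_mul_cyclotomic_sq_dvd hn1
      (fun d hdn hd => ?_) (cyclotomic_cube_dvd hn hn1 hV h))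
    have hq := specializesTo_X_aeval (zetaC d)
    have hs := (specializesTo_truncSquare_cTerm hn hdn hd).sub (hq.mul ((hq.qInt n).pow 2))
    rw [qInt_eq_zero (isPrimitiveRoot_zetaC (by omega)) hd hdn] at hs
    simpa using hs.map_num_eq hV h
  · obtain ⟨U, V, hV, hUV, h, hP⟩ := exists_paramDiff_fraction hn
    exact ratCongr_of_isRelPrime_fraction hV hUV h hP
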